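/- **Theorem 6.4.** Let $\Gamma$ be a totally ordered abelian group with positive cone $\Gamma^+=\{x\in\Gamma: 0\le x\}$, let $\mathcal A$ be a unital $C^*$-algebra, and let $\alpha:\Gamma^+\to\mathrm{End}(\mathcal A)$ be an action by (not necessarily unital) $*$-endomorphisms, i.e. $\alpha_0=\mathrm{id}$ and $\alpha_{x+y}=\alpha_x\circ\alpha_y$. Assume that $(\mathcal A,\Gamma^+,\alpha)$ is *finely representable*: there are a Hilbert space $H$, a faithful non-degenerate representation $\pi:\mathcal A\to L(H)$ and a semigroup homomorphism $U:\Gamma^+\to L(H)$ such that $\pi(\alpha_x(a))=U_x\pi(a)U_x^*$, $U_x^*\pi(a)U_x\in\pi(\mathcal A)$ and $U_x\pi(a)=\pi(\alpha_x(a))U_x$ for all $a\in\mathcal A$, $x\in\Gamma^+$. Let $L$ be the unique complete transfer action for $(\mathcal A,\Gamma^+,\alpha)$, i.e. the unique family of continuous positive linear maps $L_x:\mathcal A\to\mathcal A$ ($x\in\Gamma^+$) with $L_{x+y}=L_y\circ L_x$, $L_x(\alpha_x(a)b)=aL_x(b)$ and $\alpha_x(L_x(a))=\alpha_x(1)a\alpha_x(1)$.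 Let $\ell_1(\Gamma,\alpha,\mathcal A)$ be the Banach $*$-algebra of families $a=(a_g)_{g\in\Gamma}$ with $a_x\in\mathcal A\alpha_x(1)$ and $a_{-x}\in\alpha_x(1)\mathcal A$ for $x\in\Gamma^+$ and $\|a\|_1=\sum_g\|a_g\|<\infty$, with the pointwise linear structure, the involution $(a^*)_g=a_{-g}^*$, and the continuous bilinear product determined by $(a\delta_g)(b\delta_h)=c\,\delta_{g+h}$, where $$c=\begin{cases} a\,\alpha_g(b), & g,h\ge 0,\\ a\,\alpha_{g+h}(b), & g\ge 0>h,\ g+h\ge 0,\\ \alpha_{-(g+h)}(a)\,b, & g\ge 0>h,\ g+h<0,\\ L_{-g}(ab), & g<0\le h,\ g+h\ge 0,\\ L_h(ab), & g<0\le h,\ g+h<0,\\ \alpha_{-h}(a)\,b, & g,h<0,\end{cases}$$ and $a\delta_g$ denotes the family with value $a$ at $g$ and $0$ elsewhere. The crossed product $\mathcal A\rtimes_\alpha\Gamma$ is the enveloping $C^*$-algebra of $\ell_1(\Gamma,\alpha,\mathcal A)$, i.e. its Hausdorff completion in the largest $C^*$-seminorm; let $C_0$ be the image in it of the finitely supported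 families. Then for each $g\in\Gamma$ the assignment sending the image of a finitely supported family $(a_h)_{h\in\Gamma}$ to $a_g$ is well defined on $C_0$ and extends uniquely to a continuous linear map $E_g$ from $\mathcal A\rtimes_\alpha\Gamma$ to $\mathcal A\alpha_g(1)$ if $g\ge 0$, respectively to $\alpha_{-g}(1)\mathcal A$ if $g\le 0$. Moreover, for every $a\in\mathcal A\rtimes_\alpha\Gamma$ the following conditions are equivalent: 1. $a=0$; 2. $E_g(a)=0$ for all $g\in\Gamma$; 3. $E_0(a^*a)=0$. -/

import Mathlib

open scoped ENNReal

universe u v w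

noncomputable section

namespace SemigroupCrossedProduct

/-- The positive cone `Γ⁺ = {x : Γ | 0 ≤ x}` of a totally ordered abelian group. -/
abbrev Cone (Γ : Type u) [AddCommGroup Γ] [LinearOrder Γ] : Type u := {x : Γ // 0 ≤ x}

section Cone

variable {Γ : Type u} [AddCommGroup Γ] [LinearOrder Γ] [IsOrderedAddMonoid Γ]

/-- The absolute value `|g|` (that is `g` or `-g`), as an element of the positive cone. -/
def cabs (g : Γ) : Cone Γ := ⟨|g|, abs_nonneg g⟩

theorem cabs_neg (g : Γ) : cabs (-g) = cabs g := Subtype.ext (abs_neg g)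

theorem cabs_zero : cabs (0 : Γ) = 0 := Subtype.ext abs_zero

theorem cabs_add {g h k : Γ} (H : |k| = |g| + |h|) : cabs k = cabs g + cabs h :=
  Subtype.ext H

end Cone

variable (Γ : Type u) [AddCommGroup Γ] [LinearOrder Γ] [IsOrderedAddMonoid Γ]
variable (A : Type v) [CStarAlgebra A]

/-- A C⋆-dynamical system `(A, Γ⁺, α)`: an action `α` of the positive cone `Γ⁺` on the unital
C⋆-algebra `A` by (not necessarily unital) `*`-endomorphisms. -/
structure DynSystem where
  /-- the endomorphism `α_x` -/
  act : Cone Γ → (A →⋆ₙₐ[ℂ] A)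
  act_zero : ∀ a, act 0 a = a
  act_add : ∀ x y a, act (x + y) a = act x (act y a)

variable {Γ A}

/-- `L` is a complete transfer action for `(A, Γ⁺, α)`: an action of `Γ⁺` by continuous linear
positive maps with `L_x(α_x(a) b) = a L_x(b)` and `α_x(L_x(a)) = α_x(1) a α_x(1)`. (The positive
elements of a C⋆-algebra are those of the form `b⋆ b`.) -/
structure IsCompleteTransferAction (α : DynSystem Γ A) (L : Cone Γ → (A →L[ℂ] A)) : Prop where
  add : ∀ x y a, L (x + y) a = L y (L x a)
  positive : ∀ x b, ∃ c, L x (star b * b) = star c * c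
  transfer : ∀ x a b, L x (α.act x a * b) = a * L x b
  complete : ∀ x a, α.act x (L x a) = α.act x 1 * a * α.act x 1

/-- The data `(H, π, U)` witnessing fine representability of `(A, Γ⁺, α)` on the Hilbert space `H`:
a faithful non-degenerate (i.e. unital, as `A` is unital) representation `π` of `A` on `H` and a
semigroup homomorphism `U : Γ⁺ → B(H)` with `π(α_x(a)) = U_x π(a) U_x⋆`,
`U_x⋆ π(a) U_x ∈ π(A)` and `U_x π(a) = π(α_x(a)) U_x`. -/
structure FineRepresentation (α : DynSystem Γ A) (H : Type w) [NormedAddCommGroup H]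
    [InnerProductSpace ℂ H] [CompleteSpace H] where
  /-- the representation of the coefficient algebra -/
  rep : A →⋆ₐ[ℂ] (H →L[ℂ] H)
  /-- the semigroup of operators -/
  op : Cone Γ → (H →L[ℂ] H)
  faithful : Function.Injective rep
  op_add : ∀ x y, op (x + y) = op x * op y
  rep_act : ∀ x a, rep (α.act x a) = op x * rep a * star (op x)
  conj_mem : ∀ x a, ∃ b, star (op x) * rep a * op x = rep b
  op_rep : ∀ x a, op x * rep a = rep (α.act x a) * op x

/-- `(A, Γ⁺, α)` is finely representable. -/
def FinelyRepresentable (α : DynSystem Γ A) : Prop :=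
  ∃ (H : Type w) (_ : NormedAddCommGroup H) (_ : InnerProductSpace ℂ H) (_ : CompleteSpace H),
    Nonempty (FineRepresentation α H)

section Transfer

variable {α : DynSystem Γ A}

theorem DynSystem.star_act_one (α : DynSystem Γ A) (x : Cone Γ) :
    star (α.act x 1) = α.act x 1 := by
  rw [← map_star, star_one]

theorem DynSystem.act_one_mul (α : DynSystem Γ A) (x : Cone Γ) (a : A) :
    α.act x 1 * α.act x a = α.act x a := by
  rw [← map_mul, one_mul]

theorem DynSystem.act_mul_one (α : DynSystem Γ A) (x : Cone Γ) (a : A) :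
    α.act x a * α.act x 1 = α.act x a := by
  rw [← map_mul, mul_one]

theorem IsCompleteTransferAction.apply_star {L : Cone Γ → (A →L[ℂ] A)}
    (hL : IsCompleteTransferAction α L) (x : Cone Γ) (a : A) :
    L x (star a) = star (L x a) := by
  have hpos : ∀ b, star (L x (star b * b)) = L x (star b * b) := fun b ↦ by
    obtain ⟨c, hc⟩ := hL.positive x b
    rw [hc, star_mul, star_star]
  have h1 := hpos (a + 1)
  have h2 := hpos (a + Complex.I • (1 : A))
  have h3 := hpos a
  have h4 := hpos 1
  have e1 : star (a + 1) * (a + 1) = star a * a + (star a + a) + star 1 * 1 := by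
    simp only [star_add, star_one]; noncomm_ring
  have e2 : star (a + Complex.I • (1 : A)) * (a + Complex.I • (1 : A))
      = star a * a + Complex.I • (star a - a) + star 1 * 1 := by
    simp only [star_add, star_smul, star_one, add_mul, mul_add, smul_mul_assoc, mul_smul_comm,
      one_mul, mul_one, smul_sub]
    simp [smul_smul]
    abel
  rw [e1] at h1
  rw [e2] at h2
  simp only [map_add, map_sub, map_smul, star_add, star_smul, star_sub] at h1 h2
  rw [h3, h4] at h1 h2
  have h1' := add_left_cancel (add_right_cancel h1)
  have h2' := add_left_cancel (add_right_cancel h2)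
  rw [Complex.star_def, Complex.conj_I, neg_smul, ← smul_neg] at h2'
  have h2'' := smul_right_injective A Complex.I_ne_zero h2'
  have h5 : (2 : ℂ) • L x (star a) = (2 : ℂ) • star (L x a) := by
    have h6 : L x (star a) + L x a + (L x (star a) - L x a)
        = star (L x (star a)) + star (L x a) + -(star (L x (star a)) - star (L x a)) := by
      rw [h1', h2'']
    rw [two_smul, two_smul]
    calc _ = L x (star a) + L x a + (L x (star a) - L x a) := by abel
      _ = _ := h6
      _ = _ := by abel
  exact smul_right_injective A two_ne_zero h5

theorem IsCompleteTransferAction.transfer' {L : Cone Γ → (A →L[ℂ] A)}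
    (hL : IsCompleteTransferAction α L) (x : Cone Γ) (a b : A) :
    L x (b * α.act x a) = L x b * a := by
  have h := congrArg star (hL.transfer x (star a) (star b))
  rwa [← hL.apply_star, star_mul, star_mul, star_star, ← hL.apply_star, star_star, map_star, star_star, star_star] at h

/-- A complete transfer action is unique. -/
theorem IsCompleteTransferAction.unique {L L' : Cone Γ → (A →L[ℂ] A)}
    (hL : IsCompleteTransferAction α L) (hL' : IsCompleteTransferAction α L') : L = L' := by
  have key : ∀ {L L' : Cone Γ → (A →L[ℂ] A)}, IsCompleteTransferAction α L →
      IsCompleteTransferAction α L' → ∀ x a, L x a = L x 1 * L' x a := by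
    intro L L' hL hL' x a
    have e1 : L x (α.act x 1 * a * α.act x 1) = L x a := by
      rw [hL.transfer', mul_one, hL.transfer, one_mul]
    rw [← e1, ← hL'.complete, ← hL.transfer', one_mul]
  have key' : ∀ {L L' : Cone Γ → (A →L[ℂ] A)}, IsCompleteTransferAction α L →
      IsCompleteTransferAction α L' → ∀ x a, L x a = L' x a * L x 1 := by
    intro L L' hL hL' x a
    have h := congrArg star (key hL hL' x (star a))
    simpa [hL.apply_star, hL'.apply_star, ← hL.apply_star x 1] using h
  have h1 : ∀ x, L x 1 = L' x 1 := fun x ↦ by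
    rw [key hL hL' x 1, ← key' hL' hL x 1]
  funext x
  ext a
  rw [key hL hL' x a, h1, ← key hL' hL' x a]

namespace FineRepresentation

variable {H : Type w} [NormedAddCommGroup H] [InnerProductSpace ℂ H] [CompleteSpace H]
  (R : FineRepresentation α H)

theorem norm_rep (a : A) : ‖R.rep a‖ = ‖a‖ :=
  NonUnitalStarAlgHom.norm_map R.rep R.faithful a

theorem norm_op_le (x : Cone Γ) : ‖R.op x‖ ≤ 1 := by
  have h : ‖R.op x‖ * ‖R.op x‖ ≤ 1 := by
    rw [← CStarRing.norm_self_mul_star]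
    have h1 := R.rep_act x 1
    rw [map_one R.rep, mul_one] at h1
    rw [← h1, R.norm_rep]
    refine (NonUnitalStarAlgHom.norm_apply_le (α.act x) 1).trans ?_
    have h2 : ‖(1 : A)‖ * ‖(1 : A)‖ = ‖(1 : A)‖ := by
      rw [← CStarRing.norm_star_mul_self, star_one, one_mul]
    nlinarith [norm_nonneg (1 : A), sq_nonneg (‖(1 : A)‖ - 1)]
  nlinarith [norm_nonneg (R.op x)]

/-- The map `a ↦ π⁻¹(U_x⋆ π(a) U_x)`. -/
def conj (x : Cone Γ) : A →L[ℂ] A :=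
  LinearMap.mkContinuous
    { toFun := fun a ↦ (R.conj_mem x a).choose
      map_add' := fun a b ↦ R.faithful <| by
        refine (R.conj_mem x (a + b)).choose_spec.symm.trans ?_
        rw [map_add R.rep (R.conj_mem x a).choose, ← (R.conj_mem x a).choose_spec,
          ← (R.conj_mem x b).choose_spec, map_add, mul_add, add_mul]
      map_smul' := fun c a ↦ R.faithful <| by
        refine (R.conj_mem x (c • a)).choose_spec.symm.trans ?_
        rw [RingHom.id_apply, map_smul R.rep c (R.conj_mem x a).choose,
          ← (R.conj_mem x a).choose_spec, map_smul, mul_smul_comm, smul_mul_assoc] } 1 (fun a ↦ by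
      change ‖(R.conj_mem x a).choose‖ ≤ _
      rw [← R.norm_rep, ← (R.conj_mem x a).choose_spec, one_mul, ← R.norm_rep a]
      have h1 := R.norm_op_le x
      have h2 : ‖star (R.op x)‖ ≤ 1 := by rwa [norm_star]
      calc _ ≤ ‖star (R.op x)‖ * ‖R.rep a‖ * ‖R.op x‖ := norm_mul₃_le
        _ ≤ 1 * ‖R.rep a‖ * 1 := by gcongr
        _ = _ := by ring)

theorem rep_conj (x : Cone Γ) (a : A) :
    R.rep (R.conj x a) = star (R.op x) * R.rep a * R.op x :=
  (R.conj_mem x a).choose_spec.symm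

theorem isCompleteTransferAction_conj : IsCompleteTransferAction α R.conj where
  add x y a := R.faithful <| by
    simp only [rep_conj, R.op_add, star_mul, mul_assoc]
  positive x b := by
    let := CStarAlgebra.spectralOrder A
    have := CStarAlgebra.spectralOrderedRing A
    rw [← CStarAlgebra.nonneg_iff_eq_star_mul_self]
    set d := R.conj x (star b * b) with hd
    have e : R.rep d = star (R.rep b * R.op x) * (R.rep b * R.op x) := by
      rw [hd, rep_conj, map_mul, map_star, star_mul]; simp only [mul_assoc]
    have hsa : IsSelfAdjoint d := R.faithful <| by
      rw [map_star, e, star_mul, star_star]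
    rw [StarOrderedRing.nonneg_iff_spectrum_nonneg (R := ℝ) d hsa]
    intro t ht
    rw [← hsa.map_spectrum_real R.rep R.faithful] at ht
    have h0 : 0 ≤ R.rep d := by rw [e]; exact star_mul_self_nonneg _
    exact spectrum_nonneg_of_nonneg h0 ht
  transfer x a b := R.faithful <| by
    have h := congrArg star (R.op_rep x (star a))
    simp only [star_mul, ← map_star, star_star, star_star] at h
    simp only [rep_conj, map_mul]
    rw [← mul_assoc (star (R.op x)), ← h]
    simp only [mul_assoc]
  complete x a := R.faithful <| by
    simp only [R.rep_act, rep_conj, map_mul, map_one, mul_one, mul_assoc]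

end FineRepresentation

/-- A finely representable system has exactly one complete transfer action. -/
theorem FinelyRepresentable.existsUnique_transfer (hα : FinelyRepresentable.{u, v, w} α) :
    ∃! L : Cone Γ → (A →L[ℂ] A), IsCompleteTransferAction α L := by
  obtain ⟨H, _, _, _, ⟨R⟩⟩ := hα
  exact ⟨R.conj, R.isCompleteTransferAction_conj,
    fun L hL ↦ hL.unique R.isCompleteTransferAction_conj⟩

/-- The unique complete transfer action `L` of a finely representable system. -/
def transfer (hα : FinelyRepresentable.{u, v, w} α) : Cone Γ → (A →L[ℂ] A) :=
  hα.existsUnique_transfer.choose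

theorem transfer_spec (hα : FinelyRepresentable.{u, v, w} α) :
    IsCompleteTransferAction α (transfer hα) :=
  hα.existsUnique_transfer.choose_spec.1

end Transfer

section Twist

variable {α : DynSystem Γ A}

/-- The space of admissible coefficients of degree `g`: it is `A α_x(1)` for `g = x ≥ 0` and
`α_x(1) A` for `g = -x ≤ 0` (recall that `α_x(1)` is a projection, and `α_0(1) = 1`). -/
def fiber (α : DynSystem Γ A) (g : Γ) : Submodule ℂ A where
  carrier := {a | (0 ≤ g → a * α.act (cabs g) 1 = a) ∧ (g ≤ 0 → α.act (cabs g) 1 * a = a)}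
  add_mem' ha hb := ⟨fun hg ↦ by rw [add_mul, ha.1 hg, hb.1 hg],
    fun hg ↦ by rw [mul_add, ha.2 hg, hb.2 hg]⟩
  zero_mem' := by simp
  smul_mem' c a ha := ⟨fun hg ↦ by rw [smul_mul_assoc, ha.1 hg],
    fun hg ↦ by rw [mul_smul_comm, ha.2 hg]⟩

theorem mem_fiber_of_nonneg {g : Γ} (hg : 0 ≤ g) {a : A} :
    a ∈ fiber α g ↔ ∃ b, a = b * α.act (cabs g) 1 := by
  constructor
  · exact fun h ↦ ⟨a, (h.1 hg).symm⟩
  · rintro ⟨b, rfl⟩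
    refine ⟨fun _ ↦ by rw [mul_assoc, α.act_one_mul], fun hg' ↦ ?_⟩
    obtain rfl := le_antisymm hg' hg
    rw [cabs_zero, α.act_zero, one_mul]

theorem mem_fiber_of_nonpos {g : Γ} (hg : g ≤ 0) {a : A} :
    a ∈ fiber α g ↔ ∃ b, a = α.act (cabs g) 1 * b := by
  constructor
  · exact fun h ↦ ⟨a, (h.2 hg).symm⟩
  · rintro ⟨b, rfl⟩
    refine ⟨fun hg' ↦ ?_, fun _ ↦ by rw [← mul_assoc, α.act_one_mul]⟩
    obtain rfl := le_antisymm hg hg'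
    rw [cabs_zero, α.act_zero, mul_one]

theorem isClosed_fiber (α : DynSystem Γ A) (g : Γ) : IsClosed (fiber α g : Set A) := by
  have : (fiber α g : Set A) = {a | 0 ≤ g → a * α.act (cabs g) 1 = a} ∩
      {a | g ≤ 0 → α.act (cabs g) 1 * a = a} := rfl
  rw [this]
  refine IsClosed.inter ?_ ?_
  · by_cases hg : 0 ≤ g
    · simpa [hg] using isClosed_eq (by fun_prop) (by fun_prop)
    · simp [hg]
  · by_cases hg : g ≤ 0
    · simpa [hg] using isClosed_eq (by fun_prop) (by fun_prop)
    · simp [hg]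

instance (α : DynSystem Γ A) (g : Γ) : CompleteSpace (fiber α g) :=
  (isClosed_fiber α g).completeSpace_coe

theorem star_mem_fiber {g : Γ} {a : A} (ha : a ∈ fiber α g) : star a ∈ fiber α (-g) := by
  constructor
  · intro hg
    have h := congrArg star (ha.2 (neg_nonneg.mp hg))
    rwa [star_mul, α.star_act_one, ← cabs_neg] at h
  · intro hg
    have h := congrArg star (ha.1 (neg_nonpos.mp hg))
    rwa [star_mul, α.star_act_one, ← cabs_neg] at h

/-- The coefficient of `δ_{g+h}` in the product `(a δ_g) · (b δ_h)`:
* `a α_g(b)` if `g, h ≥ 0`;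
* `a α_{g+h}(b)` if `g ≥ 0 > h` and `g + h ≥ 0`;
* `α_{-(g+h)}(a) b` if `g ≥ 0 > h` and `g + h < 0`;
* `L_{-g}(a b)` if `g < 0 ≤ h` and `g + h ≥ 0`;
* `L_h(a b)` if `g < 0 ≤ h` and `g + h < 0`;
* `α_{-h}(a) b` if `g, h < 0`. -/
def twist (hα : FinelyRepresentable.{u, v, w} α) (g h : Γ) (a b : A) : A :=
  if 0 ≤ g then
    if 0 ≤ h then a * α.act (cabs g) b
    else if 0 ≤ g + h then a * α.act (cabs (g + h)) b
    else α.act (cabs (g + h)) a * b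
  else if 0 ≤ h then
    if 0 ≤ g + h then transfer hα (cabs g) (a * b)
    else transfer hα (cabs h) (a * b)
  else α.act (cabs h) a * b

variable (hα : FinelyRepresentable.{u, v, w} α)

theorem twist_mem {g h : Γ} {a b : A} (ha : a ∈ fiber α g) (hb : b ∈ fiber α h) :
    twist hα g h a b ∈ fiber α (g + h) := by
  have hL := transfer_spec hα
  unfold twist
  split_ifs with hg hh hgh hh hgh
  · rw [mem_fiber_of_nonneg (add_nonneg hg hh)]
    refine ⟨a * α.act (cabs g) b, ?_⟩
    rw [cabs_add (g := g) (h := h) (k := g + h) (by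
      rw [abs_of_nonneg hg, abs_of_nonneg hh, abs_of_nonneg (add_nonneg hg hh)]), α.act_add, mul_assoc, ← map_mul,
      hb.1 hh]
  · rw [mem_fiber_of_nonneg hgh]
    exact ⟨a * α.act (cabs (g + h)) b, by rw [mul_assoc, α.act_mul_one]⟩
  · rw [mem_fiber_of_nonpos (not_le.mp hgh).le]
    exact ⟨α.act (cabs (g + h)) a * b, by rw [← mul_assoc, α.act_one_mul]⟩
  · rw [mem_fiber_of_nonneg hgh]
    refine ⟨transfer hα (cabs g) (a * b), ?_⟩
    have e : cabs h = cabs g + cabs (g + h) := cabs_add <| by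
      rw [abs_of_nonneg hh, abs_of_neg (not_le.mp hg), abs_of_nonneg hgh]; abel
    rw [← hL.transfer', mul_assoc, ← α.act_add, ← e, hb.1 hh]
  · have hg' := (not_le.mp hg).le
    have hgh' := (not_le.mp hgh).le
    rw [mem_fiber_of_nonpos hgh']
    refine ⟨transfer hα (cabs h) (a * b), ?_⟩
    have e : cabs g = cabs h + cabs (g + h) := cabs_add <| by
      rw [abs_of_nonneg hh, abs_of_nonpos hg', abs_of_nonpos hgh']; abel
    rw [← hL.transfer, ← mul_assoc, ← α.act_add, ← e, ha.2 hg']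
  · have hg' := (not_le.mp hg).le
    have hh' := (not_le.mp hh).le
    rw [mem_fiber_of_nonpos (add_nonpos hg' hh')]
    refine ⟨α.act (cabs h) a * b, ?_⟩
    have e : cabs (g + h) = cabs h + cabs g := cabs_add <| by
      rw [abs_of_nonpos hg', abs_of_nonpos hh', abs_of_nonpos (add_nonpos hg' hh')]; abel
    rw [e, α.act_add, ← mul_assoc, ← map_mul, ha.2 hg']

theorem norm_transfer_le (x : Cone Γ) (a : A) : ‖transfer hα x a‖ ≤ ‖a‖ := by
  have hL := transfer_spec hα
  obtain ⟨H, _, _, _, ⟨R⟩⟩ := hα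
  rw [hL.unique R.isCompleteTransferAction_conj]
  simpa using R.conj x |>.le_of_opNorm_le (LinearMap.mkContinuous_norm_le _ zero_le_one _) a

theorem norm_act_le (x : Cone Γ) (a : A) : ‖α.act x a‖ ≤ ‖a‖ :=
  NonUnitalStarAlgHom.norm_apply_le (α.act x) a

theorem norm_twist_le (g h : Γ) (a b : A) : ‖twist hα g h a b‖ ≤ ‖a‖ * ‖b‖ := by
  unfold twist
  split_ifs
  · exact (norm_mul_le _ _).trans (by gcongr; exact norm_act_le _ _)
  · exact (norm_mul_le _ _).trans (by gcongr; exact norm_act_le _ _)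
  · exact (norm_mul_le _ _).trans (by gcongr; exact norm_act_le _ _)
  · exact (norm_transfer_le hα _ _).trans (norm_mul_le _ _)
  · exact (norm_transfer_le hα _ _).trans (norm_mul_le _ _)
  · exact (norm_mul_le _ _).trans (by gcongr; exact norm_act_le _ _)

theorem twist_add_left (g h : Γ) (a a' b : A) :
    twist hα g h (a + a') b = twist hα g h a b + twist hα g h a' b := by
  unfold twist; split_ifs <;> simp [add_mul]

theorem twist_add_right (g h : Γ) (a b b' : A) :
    twist hα g h a (b + b') = twist hα g h a b + twist hα g h a b' := by
  unfold twist; split_ifs <;> simp [mul_add]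

theorem twist_smul_left (g h : Γ) (c : ℂ) (a b : A) :
    twist hα g h (c • a) b = c • twist hα g h a b := by
  unfold twist; split_ifs <;> simp

theorem twist_smul_right (g h : Γ) (c : ℂ) (a b : A) :
    twist hα g h a (c • b) = c • twist hα g h a b := by
  unfold twist; split_ifs <;> simp

namespace FineRepresentation

variable {H : Type w} [NormedAddCommGroup H] [InnerProductSpace ℂ H] [CompleteSpace H]
  (R : FineRepresentation α H)

/-- The operator of degree `g` with coefficient `a`: `π(a) U_g` or `U_{-g}⋆ π(a)`. -/
def homog (g : Γ) (a : A) : H →L[ℂ] H :=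
  if 0 ≤ g then R.rep a * R.op (cabs g) else star (R.op (cabs g)) * R.rep a

theorem rep_transfer (x : Cone Γ) (a : A) :
    R.rep (transfer hα x a) = star (R.op x) * R.rep a * R.op x := by
  rw [(transfer_spec hα).unique R.isCompleteTransferAction_conj, R.rep_conj]

theorem op_mul_star (x : Cone Γ) : R.op x * star (R.op x) = R.rep (α.act x 1) := by
  rw [R.rep_act, map_one R.rep, mul_one]

theorem rep_star_op (x : Cone Γ) (a : A) :
    R.rep a * star (R.op x) = star (R.op x) * R.rep (α.act x a) := by
  have h := congrArg star (R.op_rep x (star a))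
  simpa only [star_mul, ← map_star, star_star] using h

theorem homog_injective {g : Γ} {a b : A} (ha : a ∈ fiber α g) (hb : b ∈ fiber α g)
    (h : R.homog g a = R.homog g b) : a = b := by
  apply R.faithful
  unfold homog at h
  split_ifs at h with hg
  · have h := congrArg (· * star (R.op (cabs g))) h
    simp only [mul_assoc, R.op_mul_star] at h
    rwa [← map_mul, ← map_mul, ha.1 hg, hb.1 hg] at h
  · have hg' := (not_le.mp hg).le
    have h := congrArg (R.op (cabs g) * ·) h
    simp only [← mul_assoc, R.op_mul_star] at h
    rwa [← map_mul, ← map_mul, ha.2 hg', hb.2 hg'] at h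

theorem op_zero : R.op 0 = 1 := by
  have h1 : R.op 0 * star (R.op 0) = 1 := by
    rw [R.op_mul_star, α.act_zero, map_one]
  have h2 : R.op 0 * R.op 0 = R.op 0 := by rw [← R.op_add, add_zero]
  calc R.op 0 = R.op 0 * (R.op 0 * star (R.op 0)) := by rw [h1, mul_one]
    _ = 1 := by rw [← mul_assoc, h2, h1]

theorem star_homog (g : Γ) (a : A) : star (R.homog g a) = R.homog (-g) (star a) := by
  unfold homog
  rcases lt_trichotomy g 0 with hg | rfl | hg
  · rw [if_neg hg.not_ge, if_pos (neg_nonneg.mpr hg.le), cabs_neg, star_mul, star_star, map_star]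
  · simp [cabs_zero, R.op_zero, map_star]
  · rw [if_pos hg.le, if_neg (by simpa using hg), cabs_neg, star_mul, map_star]

theorem homog_twist {g h : Γ} {a b : A} (ha : a ∈ fiber α g) (hb : b ∈ fiber α h) :
    R.homog (g + h) (twist hα g h a b) = R.homog g a * R.homog h b := by
  unfold twist
  split_ifs with hg hh hgh hh hgh
  · simp only [homog, if_pos hg, if_pos hh, if_pos (add_nonneg hg hh)]
    rw [cabs_add (g := g) (h := h) (k := g + h) (by
      rw [abs_of_nonneg hg, abs_of_nonneg hh, abs_of_nonneg (add_nonneg hg hh)]), R.op_add, map_mul,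
      mul_assoc, mul_assoc, ← mul_assoc (R.rep (α.act _ _)), ← R.op_rep, mul_assoc]
  · simp only [homog, if_pos hg, if_neg hh, if_pos hgh]
    have hh' := (not_le.mp hh).le
    have e : cabs g = cabs (g + h) + cabs h := cabs_add <| by
      rw [abs_of_nonneg hg, abs_of_nonpos hh', abs_of_nonneg hgh]; abel
    rw [e, R.op_add, map_mul, mul_assoc, ← R.op_rep]
    calc _ = R.rep a * (R.op (cabs (g + h)) * R.rep (α.act (cabs h) 1 * b)) := by rw [hb.2 hh']
      _ = _ := by rw [map_mul, ← R.op_mul_star]; simp only [mul_assoc]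
  · have hh' := (not_le.mp hh).le
    have hgh' := (not_le.mp hgh).le
    simp only [homog, if_pos hg, if_neg hh, if_neg hgh]
    have e : cabs h = cabs (g + h) + cabs g := cabs_add <| by
      rw [abs_of_nonneg hg, abs_of_nonpos hh', abs_of_nonpos hgh']; abel
    rw [e, R.op_add, map_mul, ← mul_assoc, ← R.rep_star_op]
    calc _ = R.rep (a * α.act (cabs g) 1) * star (R.op (cabs (g + h))) * R.rep b := by
          rw [ha.1 hg]
      _ = _ := by rw [map_mul, ← R.op_mul_star, star_mul]; simp only [mul_assoc]
  · simp only [homog, if_neg hg, if_pos hh, if_pos hgh]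
    have e : cabs h = cabs g + cabs (g + h) := cabs_add <| by
      rw [abs_of_nonneg hh, abs_of_neg (not_le.mp hg), abs_of_nonneg hgh]; abel
    rw [e, R.op_add, R.rep_transfer, map_mul]
    simp only [mul_assoc]
  · have hg' := (not_le.mp hg).le
    have hgh' := (not_le.mp hgh).le
    simp only [homog, if_neg hg, if_pos hh, if_neg hgh]
    have e : cabs g = cabs h + cabs (g + h) := cabs_add <| by
      rw [abs_of_nonneg hh, abs_of_nonpos hg', abs_of_nonpos hgh']; abel
    rw [e, R.op_add, R.rep_transfer, map_mul, star_mul]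
    simp only [mul_assoc]
  · have hg' := (not_le.mp hg).le
    have hh' := (not_le.mp hh).le
    have hgh : ¬ 0 ≤ g + h := not_le.mpr (add_neg (not_le.mp hg) (not_le.mp hh))
    simp only [homog, if_neg hg, if_neg hh, if_neg hgh]
    have e : cabs (g + h) = cabs h + cabs g := cabs_add <| by
      rw [abs_of_nonpos hg', abs_of_nonpos hh', abs_of_nonpos (add_nonpos hg' hh')]; abel
    rw [e, R.op_add, map_mul, star_mul, mul_assoc, ← mul_assoc (star (R.op (cabs h))),
      ← R.rep_star_op]
    simp only [mul_assoc]

end FineRepresentation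

theorem twist_assoc {g h k : Γ} {a b c : A} (ha : a ∈ fiber α g) (hb : b ∈ fiber α h)
    (hc : c ∈ fiber α k) :
    twist hα (g + h) k (twist hα g h a b) c = twist hα g (h + k) a (twist hα h k b c) := by
  obtain ⟨H, _, _, _, ⟨R⟩⟩ := id hα
  refine R.homog_injective (twist_mem hα (twist_mem hα ha hb) hc)
    (add_assoc g h k ▸ twist_mem hα ha (twist_mem hα hb hc)) ?_
  rw [R.homog_twist hα (twist_mem hα ha hb) hc, R.homog_twist hα ha hb, add_assoc,
    R.homog_twist hα ha (twist_mem hα hb hc), R.homog_twist hα hb hc, mul_assoc]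

theorem star_twist {g h : Γ} {a b : A} (ha : a ∈ fiber α g) (hb : b ∈ fiber α h) :
    star (twist hα g h a b) = twist hα (-h) (-g) (star b) (star a) := by
  obtain ⟨H, _, _, _, ⟨R⟩⟩ := id hα
  have e : -(g + h) = -h + -g := neg_add_rev g h
  refine R.homog_injective (star_mem_fiber (twist_mem hα ha hb))
    (e ▸ twist_mem hα (star_mem_fiber hb) (star_mem_fiber ha)) ?_
  rw [← R.star_homog, R.homog_twist hα ha hb, star_mul, R.star_homog, R.star_homog, e,
    R.homog_twist hα (star_mem_fiber hb) (star_mem_fiber ha)]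

theorem one_twist {h : Γ} {b : A} (hb : b ∈ fiber α h) : twist hα 0 h 1 b = b := by
  unfold twist
  simp only [le_refl, if_true, zero_add, cabs_zero, α.act_zero, one_mul]
  split_ifs with hh
  · rfl
  · exact hb.2 (not_le.mp hh).le

theorem one_mem_fiber : (1 : A) ∈ fiber α 0 := by
  constructor <;> simp [cabs_zero, α.act_zero]

end Twist

section L1

variable {α : DynSystem Γ A}

/-- The space `ℓ¹(Γ, α, A)`: the families `(a_g)` with `a_g` an admissible coefficient of degree
`g` and `∑ ‖a_g‖ < ∞`. -/
def L1 (_hα : FinelyRepresentable.{u, v, w} α) : Type (max u v) :=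
  lp (fun g : Γ ↦ fiber α g) 1

namespace L1

variable (hα : FinelyRepresentable.{u, v, w} α)

instance : NormedAddCommGroup (L1 hα) :=
  inferInstanceAs (NormedAddCommGroup (lp (fun g : Γ ↦ fiber α g) 1))

instance : NormedSpace ℂ (L1 hα) :=
  inferInstanceAs (NormedSpace ℂ (lp (fun g : Γ ↦ fiber α g) 1))

instance : CompleteSpace (L1 hα) :=
  inferInstanceAs (CompleteSpace (lp (fun g : Γ ↦ fiber α g) 1))

variable {hα}

/-- The coefficient `a_g` of an element of `ℓ¹(Γ, α, A)`. -/
def coeff (a : L1 hα) (g : Γ) : fiber α g :=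
  (show lp (fun g : Γ ↦ fiber α g) 1 from a) g

theorem ext {a b : L1 hα} (h : ∀ g, a.coeff g = b.coeff g) : a = b :=
  lp.ext (funext h)

theorem hasSum_norm (a : L1 hα) : HasSum (fun g ↦ ‖a.coeff g‖) ‖a‖ := by
  have h := lp.hasSum_norm (p := 1) (by simp) (show lp (fun g : Γ ↦ fiber α g) 1 from a)
  simp only [ENNReal.toReal_one, Real.rpow_one] at h
  exact h

variable (hα) in
/-- The element `a δ_g`. -/
def single (g : Γ) : fiber α g →L[ℂ] L1 hα :=
  lp.singleContinuousLinearMap ℂ (fun g : Γ ↦ fiber α g) 1 g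

theorem norm_single (g : Γ) (a : fiber α g) : ‖single hα g a‖ = ‖a‖ :=
  lp.norm_single (E := fun g : Γ ↦ fiber α g) one_pos g a

theorem coeff_single_self (g : Γ) (a : fiber α g) : (single hα g a).coeff g = a :=
  lp.single_apply_self (E := fun g : Γ ↦ fiber α g) 1 g a

theorem coeff_single_of_ne {g h : Γ} (a : fiber α g) (hne : h ≠ g) :
    (single hα g a).coeff h = 0 :=
  lp.single_apply_ne (E := fun g : Γ ↦ fiber α g) 1 g a hne

theorem hasSum_single (a : L1 hα) : HasSum (fun g ↦ single hα g (a.coeff g)) a :=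
  lp.hasSum_single ENNReal.one_ne_top (show lp (fun g : Γ ↦ fiber α g) 1 from a)

theorem clm_ext {F : Type*} [AddCommMonoid F] [Module ℂ F] [TopologicalSpace F] [T2Space F]
    {S T : L1 hα →L[ℂ] F} (h : ∀ g a, S (single hα g a) = T (single hα g a)) : S = T :=
  lp.ext_continuousLinearMap ENNReal.one_ne_top fun g ↦ ContinuousLinearMap.ext (h g)

variable (hα) in
/-- `twist` as a map between the coefficient spaces. -/
def twistFiber (g h : Γ) (a : fiber α g) (b : fiber α h) : fiber α (g + h) :=
  ⟨twist hα g h a b, twist_mem hα a.2 b.2⟩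

theorem norm_term_le (a b : L1 hα) (p : Γ × Γ) :
    ‖single hα (p.1 + p.2) (twistFiber hα p.1 p.2 (a.coeff p.1) (b.coeff p.2))‖ ≤
      ‖a.coeff p.1‖ * ‖b.coeff p.2‖ := by
  rw [norm_single]
  exact norm_twist_le hα _ _ _ _

theorem hasSum_norm_mul (a b : L1 hα) :
    HasSum (fun p : Γ × Γ ↦ ‖a.coeff p.1‖ * ‖b.coeff p.2‖) (‖a‖ * ‖b‖) :=
  HasSum.mul (f := fun g ↦ ‖a.coeff g‖) (g := fun h ↦ ‖b.coeff h‖) a.hasSum_norm b.hasSum_norm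
    (Summable.mul_of_nonneg (f := fun g ↦ ‖a.coeff g‖) (g := fun h ↦ ‖b.coeff h‖)
      a.hasSum_norm.summable b.hasSum_norm.summable
      (fun _ ↦ norm_nonneg _) (fun _ ↦ norm_nonneg _))

theorem summable_term (a b : L1 hα) : Summable (fun p : Γ × Γ ↦
    single hα (p.1 + p.2) (twistFiber hα p.1 p.2 (a.coeff p.1) (b.coeff p.2))) :=
  Summable.of_norm_bounded (hasSum_norm_mul a b).summable (norm_term_le a b)

/-- The product of `ℓ¹(Γ, α, A)`: the (absolutely convergent) sum of all the products
`(a_g δ_g) · (b_h δ_h)`, each of which lies in degree `g + h`. -/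
instance : Mul (L1 hα) :=
  ⟨fun a b ↦ ∑' p : Γ × Γ,
    single hα (p.1 + p.2) (twistFiber hα p.1 p.2 (a.coeff p.1) (b.coeff p.2))⟩

theorem mul_def (a b : L1 hα) : a * b = ∑' p : Γ × Γ,
    single hα (p.1 + p.2) (twistFiber hα p.1 p.2 (a.coeff p.1) (b.coeff p.2)) := rfl

theorem norm_mul_le' (a b : L1 hα) : ‖a * b‖ ≤ ‖a‖ * ‖b‖ :=
  tsum_of_norm_bounded (hasSum_norm_mul a b) (norm_term_le a b)

theorem coeff_add (a b : L1 hα) (g : Γ) : (a + b).coeff g = a.coeff g + b.coeff g := rfl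

theorem coeff_smul (c : ℂ) (a : L1 hα) (g : Γ) : (c • a).coeff g = c • a.coeff g := rfl

theorem coeff_zero (g : Γ) : (0 : L1 hα).coeff g = 0 := rfl

variable (hα) in
/-- The product as a continuous bilinear map. -/
def mulCLM : L1 hα →L[ℂ] L1 hα →L[ℂ] L1 hα :=
  LinearMap.mkContinuous₂
    (LinearMap.mk₂ ℂ (fun a b : L1 hα ↦ a * b)
      (fun a a' b ↦ by
        simp only [mul_def]
        rw [← (summable_term a b).tsum_add (summable_term a' b)]
        refine tsum_congr fun p ↦ ?_
        rw [← map_add]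
        exact congrArg _ (Subtype.ext (twist_add_left hα _ _ _ _ _)))
      (fun c a b ↦ by
        simp only [mul_def]
        rw [← (summable_term a b).tsum_const_smul]
        refine tsum_congr fun p ↦ ?_
        rw [← map_smul]
        exact congrArg _ (Subtype.ext (twist_smul_left hα _ _ _ _ _)))
      (fun a b b' ↦ by
        simp only [mul_def]
        rw [← (summable_term a b).tsum_add (summable_term a b')]
        refine tsum_congr fun p ↦ ?_
        rw [← map_add]
        exact congrArg _ (Subtype.ext (twist_add_right hα _ _ _ _ _)))
      (fun c a b ↦ by
        simp only [mul_def]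
        rw [← (summable_term a b).tsum_const_smul]
        refine tsum_congr fun p ↦ ?_
        rw [← map_smul]
        exact congrArg _ (Subtype.ext (twist_smul_right hα _ _ _ _ _))))
    1 (fun a b ↦ by rw [one_mul]; exact norm_mul_le' a b)

theorem mulCLM_apply (a b : L1 hα) : mulCLM hα a b = a * b := rfl

theorem single_mul_single (g h : Γ) (a : fiber α g) (b : fiber α h) :
    single hα g a * single hα h b = single hα (g + h) (twistFiber hα g h a b) := by
  rw [mul_def, tsum_eq_single (g, h), coeff_single_self, coeff_single_self]
  rintro ⟨g', h'⟩ hne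
  have : twistFiber hα g' h' ((single hα g a).coeff g') ((single hα h b).coeff h') = 0 := by
    apply norm_le_zero_iff.mp
    refine (norm_twist_le hα _ _ _ _).trans_eq ?_
    by_cases h1 : g' = g
    · have h2 : h' ≠ h := fun h2 ↦ hne (by rw [h1, h2])
      simp [coeff_single_of_ne b h2]
    · simp [coeff_single_of_ne a h1]
  rw [this, map_zero]

theorem coe_coeff_single (g : Γ) (a : fiber α g) (k : Γ) :
    ((single hα g a).coeff k : A) = if g = k then (a : A) else 0 := by
  split_ifs with e
  · subst e; rw [coeff_single_self]
  · rw [coeff_single_of_ne a (Ne.symm e)]; rfl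

/-- The coefficients of a product: `(a b)_k = ∑_g (a_g δ_g · b_{k-g} δ_{k-g})_k`. -/
theorem hasSum_coeff_mul (a b : L1 hα) (k : Γ) :
    HasSum (fun g ↦ twist hα g (k - g) (a.coeff g) (b.coeff (k - g))) ((a * b).coeff k : A) := by
  let T : L1 hα →L[ℂ] A := LinearMap.mkContinuous
    { toFun := fun a ↦ (a.coeff k : A)
      map_add' := fun _ _ ↦ rfl
      map_smul' := fun _ _ ↦ rfl } 1 (fun a ↦ by
        rw [one_mul]
        exact le_hasSum a.hasSum_norm k fun _ _ ↦ norm_nonneg _)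
  have h1 := (summable_term a b).hasSum.mapL T
  have hinj : Function.Injective (fun g : Γ ↦ (g, k - g)) := fun g g' h ↦ (Prod.ext_iff.mp h).1
  have hT : ∀ p : Γ × Γ, T (single hα (p.1 + p.2)
      (twistFiber hα p.1 p.2 (a.coeff p.1) (b.coeff p.2))) =
      if p.1 + p.2 = k then twist hα p.1 p.2 (a.coeff p.1) (b.coeff p.2) else 0 :=
    fun p ↦ coe_coeff_single _ _ _
  simp only [hT] at h1
  have h2 := (hinj.hasSum_iff (fun p hp ↦ if_neg fun e ↦ hp ⟨p.1, by
    simp only [← e, add_sub_cancel_left]⟩)).mpr h1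
  simp only [Function.comp_def, add_sub_cancel, if_true] at h2
  exact h2

theorem single_congr {g h : Γ} (e : g = h) {a : fiber α g} {b : fiber α h}
    (hab : (a : A) = b) : single hα g a = single hα h b := by
  subst e
  rw [Subtype.ext hab]

/-- The involution of `ℓ¹(Γ, α, A)`: `(a⋆)_g = (a_{-g})⋆`. -/
instance : Star (L1 hα) :=
  ⟨fun a ↦ (⟨fun g ↦ ⟨star (a.coeff (-g) : A), by
      simpa using star_mem_fiber (a.coeff (-g)).2⟩, memℓp_gen (by
        have h := a.hasSum_norm.summable.comp_injective (neg_injective (G := Γ))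
        refine h.congr fun g ↦ ?_
        simp only [ENNReal.toReal_one, Real.rpow_one, Function.comp]
        exact (norm_star (a.coeff (-g) : A)).symm)⟩ : lp (fun g : Γ ↦ fiber α g) 1)⟩

theorem coe_coeff_star (a : L1 hα) (g : Γ) :
    ((star a).coeff g : A) = star (a.coeff (-g) : A) := rfl

theorem norm_star' (a : L1 hα) : ‖star a‖ = ‖a‖ := by
  have h1 := (star a).hasSum_norm
  have h2 := (Equiv.neg Γ).hasSum_iff.mpr a.hasSum_norm
  have e : (fun g ↦ ‖(star a).coeff g‖) = (fun g ↦ ‖a.coeff g‖) ∘ ⇑(Equiv.neg Γ) :=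
    funext fun g ↦ norm_star (a.coeff (-g) : A)
  rw [e] at h1
  exact h1.unique h2

instance : StarAddMonoid (L1 hα) where
  star_involutive a := ext fun g ↦ Subtype.ext <| by
    rw [coe_coeff_star, coe_coeff_star, star_star, neg_neg]
  star_add a b := ext fun g ↦ Subtype.ext <| by
    simp [coe_coeff_star, coeff_add]

instance : StarModule ℂ (L1 hα) where
  star_smul c a := ext fun g ↦ Subtype.ext <| by
    simp [coe_coeff_star, coeff_smul]

instance : NormedStarGroup (L1 hα) where
  norm_star_le a := (norm_star' a).le

theorem star_single (g : Γ) (a : fiber α g) :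
    star (single hα g a) = single hα (-g) ⟨star (a : A), star_mem_fiber a.2⟩ := by
  refine ext fun h ↦ Subtype.ext ?_
  rw [coe_coeff_star]
  by_cases e : h = -g
  · obtain rfl : g = -h := by rw [e, neg_neg]
    have e2 : single hα (-(-h)) ⟨star (a : A), star_mem_fiber a.2⟩ =
        single hα h ⟨star (a : A), by simpa using star_mem_fiber a.2⟩ :=
      single_congr (neg_neg h) rfl
    rw [coeff_single_self, e2, coeff_single_self]
  · rw [coeff_single_of_ne _ e, coeff_single_of_ne _ (fun e' ↦ e (by rw [← e', neg_neg]))]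
    simp

/-- The unit `1 δ_0`. -/
instance : One (L1 hα) := ⟨single hα 0 ⟨1, one_mem_fiber⟩⟩

theorem one_def : (1 : L1 hα) = single hα 0 ⟨1, one_mem_fiber⟩ := rfl

theorem mul_assoc' (a b c : L1 hα) : a * b * c = a * (b * c) := by
  refine DFunLike.congr_fun (clm_ext (S := ((mulCLM hα).flip c).comp ((mulCLM hα).flip b))
    (T := (mulCLM hα).flip (b * c)) fun g x ↦ ?_) a
  change single hα g x * b * c = single hα g x * (b * c)
  refine DFunLike.congr_fun (clm_ext (S := ((mulCLM hα).flip c).comp (mulCLM hα (single hα g x)))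
    (T := (mulCLM hα (single hα g x)).comp ((mulCLM hα).flip c)) fun h y ↦ ?_) b
  change single hα g x * single hα h y * c = single hα g x * (single hα h y * c)
  refine DFunLike.congr_fun (clm_ext (S := mulCLM hα (single hα g x * single hα h y))
    (T := (mulCLM hα (single hα g x)).comp (mulCLM hα (single hα h y))) fun k z ↦ ?_) c
  change single hα g x * single hα h y * single hα k z
    = single hα g x * (single hα h y * single hα k z)
  simp only [single_mul_single]
  exact single_congr (add_assoc g h k) (twist_assoc hα x.2 y.2 z.2)

theorem one_mul' (a : L1 hα) : 1 * a = a := by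
  refine DFunLike.congr_fun (clm_ext (S := mulCLM hα 1)
    (T := ContinuousLinearMap.id ℂ (L1 hα)) fun g x ↦ ?_) a
  change 1 * single hα g x = single hα g x
  rw [one_def, single_mul_single]
  exact single_congr (zero_add g) (one_twist hα x.2)

theorem star_mul' (a b : L1 hα) : star (a * b) = star b * star a := by
  have h1 := (summable_term a b).hasSum.star
  have h2 := ((Equiv.prodComm Γ Γ).trans ((Equiv.neg Γ).prodCongr (Equiv.neg Γ))).hasSum_iff.mpr
    (summable_term (star b) (star a)).hasSum
  rw [← mul_def] at h2
  refine h1.unique ?_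
  convert h2 using 1
  funext p
  rw [star_single]
  refine single_congr (neg_add_rev p.1 p.2) ?_
  refine (star_twist hα (a.coeff p.1).2 (b.coeff p.2).2).trans ?_
  change _ = twist hα (-p.2) (-p.1) ((star b).coeff (-p.2)) ((star a).coeff (-p.1))
  rw [coe_coeff_star, coe_coeff_star, neg_neg, neg_neg]

theorem star_one' : star (1 : L1 hα) = 1 := by
  rw [one_def, star_single]
  exact single_congr neg_zero (star_one A)

theorem mul_one' (a : L1 hα) : a * 1 = a := by
  rw [← star_star (a * 1), star_mul', star_one', one_mul', star_star]

/-- `ℓ¹(Γ, α, A)` is a Banach algebra. -/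
instance : NormedRing (L1 hα) where
  __ := (inferInstance : NormedAddCommGroup (L1 hα))
  left_distrib a b c := map_add (mulCLM hα a) b c
  right_distrib a b c := congrArg (· c) (map_add (mulCLM hα) a b)
  zero_mul a := congrArg (· a) (map_zero (mulCLM hα))
  mul_zero a := map_zero (mulCLM hα a)
  mul_assoc := mul_assoc'
  one_mul := one_mul'
  mul_one := mul_one'
  norm_mul_le := norm_mul_le'

instance : NormedAlgebra ℂ (L1 hα) where
  __ := Algebra.ofModule (R := ℂ) (A := L1 hα)
    (fun c a b ↦ congrArg (· b) (map_smul (mulCLM hα) c a))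
    (fun c a b ↦ map_smul (mulCLM hα a) c b)
  norm_smul_le := norm_smul_le

instance : StarRing (L1 hα) where
  __ := (inferInstance : StarAddMonoid (L1 hα))
  star_mul := star_mul'

end L1

end L1

section CrossedProduct

variable {α : DynSystem Γ A}

/-- `p` is a C⋆-seminorm on the Banach `*`-algebra `ℓ¹(Γ, α, A)`. (Every C⋆-seminorm on a Banach
`*`-algebra with isometric involution satisfies `p ≤ ‖·‖` automatically, and the C⋆-seminorms are
exactly the functions `a ↦ ‖ρ(a)‖` for the `*`-representations `ρ` by bounded operators on Hilbert
spaces.) -/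
structure IsCStarSeminorm {hα : FinelyRepresentable.{u, v, w} α} (p : Seminorm ℂ (L1 hα)) :
    Prop where
  le_norm : ∀ a, p a ≤ ‖a‖
  mul_le : ∀ a b, p (a * b) ≤ p a * p b
  star_mul_self : ∀ a, p (star a * a) = p a * p a

variable (hα : FinelyRepresentable.{u, v, w} α)

theorem isCStarSeminorm_zero : IsCStarSeminorm (0 : Seminorm ℂ (L1 hα)) where
  le_norm a := norm_nonneg a
  mul_le a b := by simp
  star_mul_self a := by simp

instance : Nonempty {p : Seminorm ℂ (L1 hα) // IsCStarSeminorm p} :=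
  ⟨⟨0, isCStarSeminorm_zero hα⟩⟩

variable {hα}

theorem IsCStarSeminorm.star_eq {p : Seminorm ℂ (L1 hα)} (hp : IsCStarSeminorm p) (a : L1 hα) :
    p (star a) = p a := by
  have key : ∀ b, p b ≤ p (star b) := fun b ↦ by
    have h := (hp.star_mul_self b).symm.trans_le (hp.mul_le (star b) b)
    rcases (apply_nonneg p b).eq_or_lt with h0 | h0
    · rw [← h0]; exact apply_nonneg p _
    · exact le_of_mul_le_mul_right h h0
  refine le_antisymm ?_ (key a)
  simpa using key (star a)

theorem bddAbove_cstarSeminorm (a : L1 hα) :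
    BddAbove (Set.range fun p : {p : Seminorm ℂ (L1 hα) // IsCStarSeminorm p} ↦ p.1 a) :=
  ⟨‖a‖, by rintro _ ⟨p, rfl⟩; exact p.2.le_norm a⟩

/-- The largest C⋆-seminorm: `‖a‖_* = sup {p(a) | p a C⋆-seminorm}`. -/
def maxNorm (a : L1 hα) : ℝ := ⨆ p : {p : Seminorm ℂ (L1 hα) // IsCStarSeminorm p}, p.1 a

theorem IsCStarSeminorm.le_maxNorm {p : Seminorm ℂ (L1 hα)} (hp : IsCStarSeminorm p)
    (a : L1 hα) : p a ≤ maxNorm a :=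
  le_ciSup (bddAbove_cstarSeminorm a) ⟨p, hp⟩

theorem maxNorm_nonneg (a : L1 hα) : 0 ≤ maxNorm a :=
  (apply_nonneg (0 : Seminorm ℂ (L1 hα)) a).trans ((isCStarSeminorm_zero hα).le_maxNorm a)

theorem maxNorm_add_le (a b : L1 hα) : maxNorm (a + b) ≤ maxNorm a + maxNorm b :=
  ciSup_le fun p ↦ (map_add_le_add p.1 a b).trans
    (add_le_add (p.2.le_maxNorm a) (p.2.le_maxNorm b))

theorem maxNorm_mul_le (a b : L1 hα) : maxNorm (a * b) ≤ maxNorm a * maxNorm b :=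
  ciSup_le fun p ↦ (p.2.mul_le a b).trans
    (mul_le_mul (p.2.le_maxNorm a) (p.2.le_maxNorm b) (apply_nonneg _ _) (maxNorm_nonneg _))

theorem maxNorm_star (a : L1 hα) : maxNorm (star a) = maxNorm a :=
  iSup_congr fun p ↦ p.2.star_eq a

theorem maxNorm_smul (c : ℂ) (a : L1 hα) : maxNorm (c • a) = ‖c‖ * maxNorm a := by
  unfold maxNorm
  rw [Real.mul_iSup_of_nonneg (norm_nonneg c)]
  exact iSup_congr fun p ↦ map_smul_eq_mul p.1 c a

theorem maxNorm_mul_self_le (a : L1 hα) : maxNorm a * maxNorm a ≤ maxNorm (star a * a) := by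
  have h0 := maxNorm_nonneg (star a * a)
  have : maxNorm a ≤ Real.sqrt (maxNorm (star a * a)) := ciSup_le fun p ↦ by
    apply Real.le_sqrt_of_sq_le
    rw [sq, ← p.2.star_mul_self]
    exact p.2.le_maxNorm _
  calc maxNorm a * maxNorm a ≤ _ := mul_self_le_mul_self (maxNorm_nonneg a) this
    _ = _ := Real.mul_self_sqrt h0

variable (hα)

/-- `ℓ¹(Γ, α, A)`, equipped with its largest C⋆-seminorm instead of its Banach space norm. -/
def PreCrossedProduct : Type (max u v) := L1 hα

namespace PreCrossedProduct

instance : Ring (PreCrossedProduct hα) := inferInstanceAs (Ring (L1 hα))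

instance : Algebra ℂ (PreCrossedProduct hα) := inferInstanceAs (Algebra ℂ (L1 hα))

instance : StarRing (PreCrossedProduct hα) := inferInstanceAs (StarRing (L1 hα))

instance : StarModule ℂ (PreCrossedProduct hα) := inferInstanceAs (StarModule ℂ (L1 hα))

instance : SeminormedRing (PreCrossedProduct hα) where
  __ := AddGroupSeminorm.toSeminormedAddCommGroup (E := PreCrossedProduct hα)
    { toFun := maxNorm (hα := hα)
      map_zero' := by
        have h := maxNorm_smul (hα := hα) 0 0
        rwa [zero_smul, norm_zero, zero_mul] at h
      add_le' := maxNorm_add_le (hα := hα)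
      neg' := fun a ↦ by
        have h := maxNorm_smul (hα := hα) (-1) (show L1 hα from a)
        rwa [neg_smul, one_smul, norm_neg, norm_one, one_mul] at h }
  __ := (inferInstance : Ring (PreCrossedProduct hα))
  norm_mul_le := maxNorm_mul_le (hα := hα)

theorem norm_def (a : PreCrossedProduct hα) : ‖a‖ = maxNorm (hα := hα) a := rfl

instance : NormedAlgebra ℂ (PreCrossedProduct hα) where
  norm_smul_le c a := (maxNorm_smul (hα := hα) c a).le

instance : NormedStarGroup (PreCrossedProduct hα) where
  norm_star_le a := (maxNorm_star (hα := hα) a).le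

end PreCrossedProduct

/-- The crossed product `A ⋊_α Γ`: the enveloping C⋆-algebra of `ℓ¹(Γ, α, A)`, i.e. its (Hausdorff)
completion in the largest C⋆-seminorm. -/
def CrossedProduct : Type (max u v) := UniformSpace.Completion (PreCrossedProduct hα)

namespace CrossedProduct

open UniformSpace

instance : NormedRing (CrossedProduct hα) :=
  inferInstanceAs (NormedRing (Completion (PreCrossedProduct hα)))

instance : CompleteSpace (CrossedProduct hα) :=
  inferInstanceAs (CompleteSpace (Completion (PreCrossedProduct hα)))

instance : Algebra ℂ (CrossedProduct hα) :=
  inferInstanceAs (Algebra ℂ (Completion (PreCrossedProduct hα)))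

instance : NormedAlgebra ℂ (CrossedProduct hα) where
  norm_smul_le c a := norm_smul_le (α := ℂ) (β := Completion (PreCrossedProduct hα)) c a

instance : Star (CrossedProduct hα) :=
  ⟨Completion.map (star : PreCrossedProduct hα → PreCrossedProduct hα)⟩

variable {hα}

/-- The canonical map `ℓ¹(Γ, α, A) → A ⋊_α Γ`. -/
def of (a : L1 hα) : CrossedProduct hα :=
  ((show PreCrossedProduct hα from a : PreCrossedProduct hα) : Completion (PreCrossedProduct hα))

theorem induction_on {P : CrossedProduct hα → Prop} (a : CrossedProduct hα)
    (hP : IsClosed {a | P a}) (h : ∀ f, P (of f)) : P a :=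
  Completion.induction_on a hP h

theorem induction_on₂ {P : CrossedProduct hα → CrossedProduct hα → Prop}
    (a b : CrossedProduct hα)
    (hP : IsClosed {p : CrossedProduct hα × CrossedProduct hα | P p.1 p.2})
    (h : ∀ f g, P (of f) (of g)) : P a b :=
  Completion.induction_on₂ a b hP h

theorem norm_of (f : L1 hα) : ‖of f‖ = maxNorm f :=
  Completion.norm_coe (E := PreCrossedProduct hα) f

theorem of_mul (f g : L1 hα) : of (f * g) = of f * of g :=
  Completion.coe_mul (α := PreCrossedProduct hα) f g

theorem of_add (f g : L1 hα) : of (f + g) = of f + of g :=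
  Completion.coe_add (α := PreCrossedProduct hα) f g

theorem of_smul (c : ℂ) (f : L1 hα) : of (c • f) = c • of f :=
  Completion.coe_smul (X := PreCrossedProduct hα) c f

theorem of_one : of (1 : L1 hα) = 1 := rfl

theorem of_star (f : L1 hα) : of (star f) = star (of f) :=
  (Completion.map_coe (α := PreCrossedProduct hα) (β := PreCrossedProduct hα)
    star_isometry.uniformContinuous f).symm

theorem continuous_star' : Continuous (star : CrossedProduct hα → CrossedProduct hα) :=
  Completion.continuous_map

instance : ContinuousStar (CrossedProduct hα) := ⟨continuous_star'⟩

instance : StarRing (CrossedProduct hα) where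
  star_involutive a := by
    refine induction_on (P := fun a ↦ star (star a) = a) a
      (isClosed_eq (continuous_star'.comp continuous_star') continuous_id) fun f ↦ ?_
    rw [← of_star, ← of_star, star_star]
  star_mul a b := by
    refine induction_on₂ (P := fun a b ↦ star (a * b) = star b * star a) a b
      (isClosed_eq (by fun_prop) (by fun_prop)) fun f g ↦ ?_
    rw [← of_mul, ← of_star, star_mul, of_mul, of_star, of_star]
  star_add a b := by
    refine induction_on₂ (P := fun a b ↦ star (a + b) = star a + star b) a b
      (isClosed_eq (by fun_prop) (by fun_prop)) fun f g ↦ ?_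
    rw [← of_add, ← of_star, star_add, of_add, of_star, of_star]

instance : StarModule ℂ (CrossedProduct hα) where
  star_smul c a := by
    have h : ∀ c : ℂ, algebraMap ℂ (CrossedProduct hα) c = of (algebraMap ℂ (L1 hα) c) :=
      fun _ ↦ rfl
    have h' : star (algebraMap ℂ (CrossedProduct hα) c)
        = algebraMap ℂ (CrossedProduct hα) (star c) := by
      rw [h, h, ← of_star, Algebra.algebraMap_eq_smul_one, star_smul, star_one,
        ← Algebra.algebraMap_eq_smul_one]
    rw [Algebra.smul_def, star_mul, h', Algebra.smul_def, Algebra.commutes]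

instance : CStarRing (CrossedProduct hα) where
  norm_mul_self_le a := by
    refine induction_on (P := fun a ↦ ‖a‖ * ‖a‖ ≤ ‖star a * a‖) a
      (isClosed_le (by fun_prop) (by fun_prop)) fun f ↦ ?_
    rw [← of_star, ← of_mul, norm_of, norm_of]
    exact maxNorm_mul_self_le f

/-- The crossed product is a unital C⋆-algebra. -/
instance : CStarAlgebra (CrossedProduct hα) where

variable (hα) in
/-- The canonical embedding of the coefficient algebra, `a ↦ a δ_0`. -/
def embed (a : A) : CrossedProduct hα :=
  of (L1.single hα 0 ⟨a, by constructor <;> simp [cabs_zero, α.act_zero]⟩)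

variable (hα) in
/-- The partial isometry `u_x` given by `α_x(1) δ_x`. -/
def shift (x : Cone Γ) : CrossedProduct hα :=
  of (L1.single hα x ⟨α.act x 1, (mem_fiber_of_nonneg x.2).mpr ⟨1, by
    rw [one_mul]; congr 2; exact (Subtype.ext (abs_of_nonneg x.2)).symm⟩⟩)

theorem cabs_coe (x : Cone Γ) : cabs (x : Γ) = x := Subtype.ext (abs_of_nonneg x.2)

theorem of_single_of_nonneg (x : Cone Γ) (a : fiber α (x : Γ)) :
    of (L1.single hα x a) = embed hα a * shift hα x := by
  rw [embed, shift, ← of_mul, L1.single_mul_single]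
  refine congrArg of (L1.single_congr (zero_add _).symm ?_)
  simp only [L1.twistFiber, twist, le_refl, if_true, x.2, cabs_zero, α.act_zero]
  simpa only [cabs_coe] using (a.2.1 x.2).symm

theorem of_single_of_nonpos (x : Cone Γ) (a : fiber α (-(x : Γ))) :
    of (L1.single hα (-(x : Γ)) a) = star (shift hα x) * embed hα a := by
  rw [embed, shift, ← of_star, L1.star_single, ← of_mul, L1.single_mul_single]
  refine congrArg of (L1.single_congr (add_zero _).symm ?_)
  have h := a.2.2 (neg_nonpos.mpr x.2)
  rw [cabs_neg, cabs_coe] at h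
  simp only [L1.twistFiber, twist, le_refl, if_true, α.star_act_one, add_zero]
  have hL := transfer_spec hα
  split_ifs with h0
  · have hx : x = 0 := Subtype.ext (le_antisymm (neg_nonneg.mp h0) x.2)
    subst hx
    simp [cabs_zero, α.act_zero]
  · rw [h, cabs_zero, ← α.act_zero (transfer hα 0 a), hL.complete]
    simp [α.act_zero]

/-- The dense `*`-subalgebra `C₀` of the elements `∑ u_x⋆ a_{-x} + a_0 + ∑ a_x u_x` (finite sums
with admissible coefficients `a_g`) is the image of the finitely supported elements of
`ℓ¹(Γ, α, A)`. A family `(E_g)` of continuous linear maps is the family of coefficient maps if `E_g`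
assigns to every such element its coefficient `a_g`. -/
def IsCoefficientFamily (E : ∀ g : Γ, CrossedProduct hα →L[ℂ] fiber α g) : Prop :=
  ∀ f : L1 hα, {g : Γ | f.coeff g ≠ 0}.Finite → ∀ g, E g (of f) = f.coeff g

end CrossedProduct

end CrossedProduct

end SemigroupCrossedProduct

end

/-! The compact dual group of `Γ` acts on ℓ¹(Γ, α, A): a character χ multiplies the coefficient of
degree g by χ(g). Product and involution respect degrees, so each χ acts as a `*`-homomorphism,
isometric for the ℓ¹-norm. It therefore permits pulling back C⋆-seminorms and does not increase the
largest one (`maxNorm_gauge_le`). Orthogonality of characters recovers coefficients by averaging: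
the integral of χ(-g) (χ·f) over the dual group is f_g δ_g (`integral_gauge`).

The maps E_g exist because of the bound ‖f_g‖ ≤ ‖f‖_* (`norm_coeff_le_maxNorm`). A fine
representation (π, U) integrates to a `*`-representation T of ℓ¹(Γ, α, A), so ‖T f‖ ≤ ‖f‖_*, and T
is isometric on each space of elements a δ_g. T need not be faithful, and its images of different
degrees may overlap; averaging over the dual action before applying T isolates degree g without
increasing the norm. Uniqueness is density.

For 3 → 2, π maps the coefficient of degree 0 of f⋆f to the sum over k of T(f_k δ_k)⋆ T(f_k δ_k).
All terms are positive, hence ‖f_g‖² ≤ ‖(f⋆f)_0‖ (`norm_coeff_sq_le`), and continuity carries this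
to the completion.

For 2 → 1, the dual action extends to a map sending a to its orbit χ ↦ χ·a, a norm-continuous
function whose Fourier coefficients are E_g(a) δ_g (`fourierCLM_orbit`). If they all vanish, every
bounded functional turns the orbit into a continuous scalar function without Fourier coefficients.
Such a function is zero by Stone–Weierstrass, and its value at the trivial character is the
functional at a. -/

noncomputable section

namespace SemigroupCrossedProduct

open MeasureTheory

/-! ### Fourier analysis on the compact dual of `Γ` -/

section Dual

/-- The group `Γ`, written multiplicatively and with the discrete topology. -/
def DiscreteGroup (Γ : Type u) : Type u := Multiplicative Γ

variable (Γ : Type u) [AddCommGroup Γ]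

instance : CommGroup (DiscreteGroup Γ) := inferInstanceAs (CommGroup (Multiplicative Γ))

instance : TopologicalSpace (DiscreteGroup Γ) := ⊥

instance : DiscreteTopology (DiscreteGroup Γ) := ⟨rfl⟩

/-- The compact group of characters of the discrete group `Γ`. -/
abbrev Dual : Type u := PontryaginDual (DiscreteGroup Γ)

instance : MeasurableSpace (Dual Γ) := borel _

instance : BorelSpace (Dual Γ) := ⟨rfl⟩

/-- The normalized Haar measure on the group of characters. -/
def haar : Measure (Dual Γ) := Measure.haarMeasure ⊤

instance : (haar Γ).IsHaarMeasure := inferInstanceAs (Measure.haarMeasure _).IsHaarMeasure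

/-- `haarMeasure K` gives `K` mass one, and here `K` is the whole compact group. Averages over the
dual group are therefore contractive. -/
instance : IsProbabilityMeasure (haar Γ) := ⟨Measure.haarMeasure_self⟩

variable {Γ}

/-- The value `χ(g)` of a character, as a complex number. -/
def eval (g : Γ) (χ : Dual Γ) : ℂ := (χ (show DiscreteGroup Γ from Multiplicative.ofAdd g) : Circle)

theorem norm_eval (g : Γ) (χ : Dual Γ) : ‖eval g χ‖ = 1 := Circle.norm_coe _

theorem eval_add (g h : Γ) (χ : Dual Γ) : eval (g + h) χ = eval g χ * eval h χ := by
  refine (congrArg _ (map_mul χ (show DiscreteGroup Γ from Multiplicative.ofAdd g)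
    (Multiplicative.ofAdd h))).trans ?_
  exact Circle.coe_mul _ _

theorem eval_zero (χ : Dual Γ) : eval (0 : Γ) χ = 1 := by
  refine (congrArg _ (map_one χ)).trans ?_
  exact Circle.coe_one

theorem eval_neg (g : Γ) (χ : Dual Γ) : eval (-g) χ = star (eval g χ) := by
  refine (congrArg _ (map_inv χ (show DiscreteGroup Γ from Multiplicative.ofAdd g))).trans ?_
  exact Circle.coe_inv_eq_conj _

theorem eval_mul (g : Γ) (χ ψ : Dual Γ) : eval g (χ * ψ) = eval g χ * eval g ψ :=
  Circle.coe_mul _ _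

theorem eval_one (g : Γ) : eval g (1 : Dual Γ) = 1 := Circle.coe_one

theorem continuous_eval (g : Γ) : Continuous (eval g : Dual Γ → ℂ) := by
  refine continuous_subtype_val.comp ?_
  exact (continuous_eval_const (F := C(DiscreteGroup Γ, Circle)) _).comp (ContinuousMonoidHom.isInducing_toContinuousMap _ _).continuous

/-- The characters separate the points of `Γ`. -/
theorem exists_eval_ne_one {g : Γ} (hg : g ≠ 0) : ∃ χ : Dual Γ, eval g χ ≠ 1 := by
  obtain ⟨c, hc⟩ := CharacterModule.exists_character_apply_ne_zero_of_ne_zero hg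
  -- The character `c` takes values in ℚ/ℤ. The inclusion `m` of ℚ/ℤ into ℝ/ℤ leads on to the
  -- circle, and its injectivity `hm` keeps the value at `g` nontrivial.
  let m : AddCircle (1 : ℚ) →+ AddCircle (1 : ℝ) :=
    QuotientAddGroup.map _ _ (Rat.castHom ℝ).toAddMonoidHom (by
      rintro _ ⟨n, rfl⟩
      exact ⟨n, by simp⟩)
  have hm : ∀ q, m q = 0 → q = 0 := by
    intro q
    induction q using QuotientAddGroup.induction_on with
    | H q =>
      intro h
      rw [QuotientAddGroup.map_mk, QuotientAddGroup.eq_zero_iff] at h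
      rw [QuotientAddGroup.eq_zero_iff]
      obtain ⟨n, hn⟩ := h
      refine ⟨n, ?_⟩
      have hn' : ((n : ℚ) : ℝ) = (q : ℝ) := by simpa using hn
      simpa using Rat.cast_injective hn'
  let χ : DiscreteGroup Γ →ₜ* Circle :=
    { toFun := fun x ↦ AddCircle.toCircle (m (c (Multiplicative.toAdd (show Multiplicative Γ from x))))
      map_one' := by
        change AddCircle.toCircle (m (c 0)) = 1
        rw [map_zero, map_zero, AddCircle.toCircle_zero]
      map_mul' := fun x y ↦ by
        change AddCircle.toCircle (m (c (_ + _))) = _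
        rw [map_add, map_add, AddCircle.toCircle_add]
      continuous_toFun := continuous_of_discreteTopology }
  refine ⟨χ, fun h ↦ hc (hm _ ?_)⟩
  refine AddCircle.injective_toCircle one_ne_zero ?_
  rw [AddCircle.toCircle_zero]
  exact Circle.ext h

theorem integrable_of_continuous {F : Type*} [NormedAddCommGroup F] {f : Dual Γ → F}
    (hf : Continuous f) : Integrable f (haar Γ) :=
  hf.integrable_of_hasCompactSupport (HasCompactSupport.of_compactSpace f)

theorem integrable_eval_smul {F : Type*} [NormedAddCommGroup F] [NormedSpace ℂ F] {f : Dual Γ → F}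
    (hf : Continuous f) (g : Γ) : Integrable (fun χ ↦ eval g χ • f χ) (haar Γ) :=
  integrable_of_continuous ((continuous_eval g).smul hf)

/-- Orthogonality of characters: translating by some ψ with ψ(g) ≠ 1 multiplies the integral by
ψ(g), while invariance of Haar measure leaves it unchanged. -/
theorem integral_eval [DecidableEq Γ] (g : Γ) :
    ∫ χ, eval g χ ∂(haar Γ) = if g = 0 then 1 else 0 := by
  split_ifs with hg
  · simp [hg, eval_zero]
  · obtain ⟨ψ, hψ⟩ := exists_eval_ne_one hg
    have h := integral_mul_left_eq_self (μ := haar Γ) (eval g) ψ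
    simp only [eval_mul, integral_const_mul] at h
    have h' : (eval g ψ - 1) * ∫ χ, eval g χ ∂(haar Γ) = 0 := by rw [sub_mul, h, one_mul, sub_self]
    exact (mul_eq_zero.mp h').resolve_left (sub_ne_zero.mpr hψ)

variable (Γ) in
/-- The trigonometric polynomials on the group of characters. -/
def trigPolynomials : StarSubalgebra ℂ C(Dual Γ, ℂ) where
  __ := Submodule.toSubalgebra (Submodule.span ℂ
      (Set.range fun g : Γ ↦ (⟨eval g, continuous_eval g⟩ : C(Dual Γ, ℂ))))
    (Submodule.subset_span ⟨0, ContinuousMap.ext eval_zero⟩) (fun p q hp hq ↦ by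
      induction hp using Submodule.span_induction with
      | zero => rw [zero_mul]; exact zero_mem _
      | add x y _ _ hx hy => rw [add_mul]; exact add_mem hx hy
      | smul c x _ hx => rw [smul_mul_assoc]; exact Submodule.smul_mem _ c hx
      | mem x hx =>
        induction hq using Submodule.span_induction with
        | zero => rw [mul_zero]; exact zero_mem _
        | add x y _ _ hx hy => rw [mul_add]; exact add_mem hx hy
        | smul c x _ hx => rw [mul_smul_comm]; exact Submodule.smul_mem _ c hx
        | mem y hy =>
          obtain ⟨g, rfl⟩ := hx
          obtain ⟨h, rfl⟩ := hy
          exact Submodule.subset_span ⟨g + h, ContinuousMap.ext (eval_add g h)⟩)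
  star_mem' {p} hp := by
    change p ∈ Submodule.span ℂ _ at hp
    change star p ∈ Submodule.span ℂ _
    induction hp using Submodule.span_induction with
    | zero => rw [star_zero]; exact zero_mem _
    | add x y _ _ hx hy => rw [star_add]; exact add_mem hx hy
    | smul c x _ hx => rw [star_smul]; exact Submodule.smul_mem _ _ hx
    | mem x hx =>
      obtain ⟨g, rfl⟩ := hx
      exact Submodule.subset_span ⟨-g, ContinuousMap.ext (eval_neg g)⟩

/-- Stone–Weierstrass. Two characters that agree under all evaluations are equal, so the evaluations
separate points. -/
theorem topologicalClosure_trigPolynomials : (trigPolynomials Γ).topologicalClosure = ⊤ := by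
  refine ContinuousMap.starSubalgebra_topologicalClosure_eq_top_of_separatesPoints _ ?_
  intro χ ψ hne
  by_contra! H
  refine hne (PontryaginDual.ext fun g ↦ Circle.ext ?_)
  exact H _ ⟨⟨eval (Multiplicative.toAdd (show Multiplicative Γ from g)), continuous_eval _⟩,
    Submodule.subset_span ⟨_, rfl⟩, rfl⟩

/-- A continuous function on the group of characters with vanishing Fourier coefficients is zero. -/
theorem eq_zero_of_fourier_eq_zero {f : C(Dual Γ, ℂ)}
    (hf : ∀ g : Γ, ∫ χ, eval g χ * f χ ∂(haar Γ) = 0) : f = 0 := by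
  -- Pairing with `f` is a bounded functional that kills the evaluations, hence their span and its
  -- closure, which is everything.
  have key : ∀ p : C(Dual Γ, ℂ), ∫ χ, p χ * f χ ∂(haar Γ) = 0 := by
    intro p
    have hp : p ∈ (trigPolynomials Γ).topologicalClosure := by
      rw [topologicalClosure_trigPolynomials]; trivial
    let T : C(Dual Γ, ℂ) →L[ℂ] ℂ := LinearMap.mkContinuous
      { toFun := fun p ↦ ∫ χ, p χ * f χ ∂(haar Γ)
        map_add' := fun p q ↦ by
          simp only [ContinuousMap.add_apply, add_mul]
          exact integral_add (integrable_of_continuous (by fun_prop))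
            (integrable_of_continuous (by fun_prop))
        map_smul' := fun c p ↦ by
          simp only [ContinuousMap.smul_apply, smul_mul_assoc, RingHom.id_apply]
          exact integral_smul _ _ } ‖f‖ (fun p ↦ by
        refine (norm_integral_le_of_norm_le_const (C := ‖p‖ * ‖f‖) (.of_forall fun χ ↦ ?_)).trans_eq ?_
        · rw [norm_mul]
          gcongr
          · exact p.norm_coe_le_norm χ
          · exact f.norm_coe_le_norm χ
        · simp [mul_comm])
    have hT : IsClosed {p | T p = 0} := isClosed_eq T.continuous continuous_const
    have hle : (trigPolynomials Γ : Set C(Dual Γ, ℂ)) ⊆ {p | T p = 0} := by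
      intro q hq
      change q ∈ Submodule.span ℂ _ at hq
      have : Submodule.span ℂ (Set.range fun g : Γ ↦ (⟨eval g, continuous_eval g⟩ : C(Dual Γ, ℂ)))
          ≤ LinearMap.ker T.toLinearMap := by
        rw [Submodule.span_le]
        rintro _ ⟨g, rfl⟩
        exact hf g
      exact this hq
    exact closure_minimal hle hT hp
  -- Testing against the conjugate of `f` turns the pairing into the integral of |f|².
  have h0 := key (star f)
  have hc : Continuous fun χ ↦ ‖f χ‖ ^ 2 := by fun_prop
  have h1 : ∫ χ, ‖f χ‖ ^ 2 ∂(haar Γ) = 0 := by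
    have : ∀ χ, (star f) χ * f χ = ((‖f χ‖ ^ 2 : ℝ) : ℂ) := fun χ ↦ by
      rw [ContinuousMap.star_apply, Complex.star_def, Complex.conj_mul']
      push_cast; rfl
    simp only [this] at h0
    rw [integral_complex_ofReal] at h0
    exact_mod_cast h0
  rw [integral_eq_zero_iff_of_nonneg (fun χ ↦ by positivity) (integrable_of_continuous hc)] at h1
  -- Haar measure charges every nonempty open set, so a continuous function that vanishes almost
  -- everywhere vanishes identically.
  have h2 := (Continuous.ae_eq_iff_eq (haar Γ) hc continuous_const).mp h1
  ext χ
  have h3 : ‖f χ‖ ^ 2 = 0 := congrFun h2 χ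
  simpa using h3

/-- A Fourier coefficient of a continuous function on the group of characters. -/
def fourierCLM (F : Type*) [NormedAddCommGroup F] [NormedSpace ℂ F] (g : Γ) :
    C(Dual Γ, F) →L[ℂ] F :=
  LinearMap.mkContinuous
    { toFun := fun f ↦ ∫ χ, eval g χ • f χ ∂(haar Γ)
      map_add' := fun f f' ↦ by
        simp only [ContinuousMap.add_apply, smul_add]
        exact integral_add (integrable_eval_smul f.continuous g) (integrable_eval_smul f'.continuous g)
      map_smul' := fun c f ↦ by
        simp only [ContinuousMap.smul_apply, smul_comm _ c, RingHom.id_apply]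
        exact integral_smul _ _ } 1 (fun f ↦ by
      refine (norm_integral_le_of_norm_le_const (C := ‖f‖) (.of_forall fun χ ↦ ?_)).trans_eq
        (by simp)
      rw [norm_smul, norm_eval, one_mul]
      exact f.norm_coe_le_norm χ)

theorem fourierCLM_apply {F : Type*} [NormedAddCommGroup F] [NormedSpace ℂ F] (g : Γ)
    (f : C(Dual Γ, F)) : fourierCLM F g f = ∫ χ, eval g χ • f χ ∂(haar Γ) := rfl

end Dual

variable {Γ : Type u} [AddCommGroup Γ] [LinearOrder Γ] [IsOrderedAddMonoid Γ]
variable {A : Type v} [CStarAlgebra A] {α : DynSystem Γ A}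
variable {hα : FinelyRepresentable.{u, v, w} α}

/-! ### The dual action on ℓ¹(Γ, α, A) -/

namespace L1

theorem norm_coeff_le (a : L1 hα) (g : Γ) : ‖a.coeff g‖ ≤ ‖a‖ :=
  le_hasSum a.hasSum_norm g fun _ _ ↦ norm_nonneg _

variable (hα) in
/-- The coefficient of degree `g`, as a continuous linear map. -/
def coeffCLM (g : Γ) : L1 hα →L[ℂ] fiber α g :=
  LinearMap.mkContinuous
    { toFun := fun a ↦ a.coeff g
      map_add' := fun _ _ ↦ rfl
      map_smul' := fun _ _ ↦ rfl } 1 (fun a ↦ by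
        rw [one_mul]
        exact a.norm_coeff_le g)

theorem coeffCLM_apply (g : Γ) (a : L1 hα) : coeffCLM hα g a = a.coeff g := rfl

theorem norm_eval_smul (χ : Dual Γ) (a : L1 hα) (g : Γ) :
    ‖eval g χ • a.coeff g‖ = ‖a.coeff g‖ := by
  rw [norm_smul, norm_eval, one_mul]

/-- The dual action: the character `χ` multiplies the coefficient of degree `g` by `χ(g)`. -/
def gaugeFun (χ : Dual Γ) (a : L1 hα) : L1 hα :=
  (⟨fun g ↦ eval g χ • a.coeff g, memℓp_gen (by
    simp only [ENNReal.toReal_one, Real.rpow_one, norm_eval_smul]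
    exact a.hasSum_norm.summable)⟩ : lp (fun g : Γ ↦ fiber α g) 1)

theorem coeff_gaugeFun (χ : Dual Γ) (a : L1 hα) (g : Γ) :
    (gaugeFun χ a).coeff g = eval g χ • a.coeff g := rfl

theorem norm_gaugeFun (χ : Dual Γ) (a : L1 hα) : ‖gaugeFun χ a‖ = ‖a‖ := by
  have h := (gaugeFun χ a).hasSum_norm
  simp only [coeff_gaugeFun, norm_eval_smul] at h
  exact h.unique a.hasSum_norm

variable (hα) in
/-- The dual action, as a continuous linear map. -/
def gauge (χ : Dual Γ) : L1 hα →L[ℂ] L1 hα :=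
  LinearMap.mkContinuous
    { toFun := gaugeFun χ
      map_add' := fun a b ↦ ext fun g ↦ smul_add _ _ _
      map_smul' := fun c a ↦ ext fun g ↦ smul_comm (eval g χ) c (a.coeff g) } 1 (fun a ↦ by
        rw [one_mul]
        exact (norm_gaugeFun χ a).le)

theorem coeff_gauge (χ : Dual Γ) (a : L1 hα) (g : Γ) :
    (gauge hα χ a).coeff g = eval g χ • a.coeff g := rfl

theorem norm_gauge (χ : Dual Γ) (a : L1 hα) : ‖gauge hα χ a‖ = ‖a‖ := norm_gaugeFun χ a

theorem gauge_one (a : L1 hα) : gauge hα 1 a = a :=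
  ext fun g ↦ by rw [coeff_gauge, eval_one, one_smul]

/-- Each term of the coefficient of degree k comes from degrees g and k - g, and χ(k) = χ(g) χ(k -
g) splits the scalar between the two factors. -/
theorem gauge_mul (χ : Dual Γ) (a b : L1 hα) :
    gauge hα χ (a * b) = gauge hα χ a * gauge hα χ b := by
  refine ext fun k ↦ Subtype.ext ?_
  rw [coeff_gauge, Submodule.coe_smul]
  refine ((hasSum_coeff_mul a b k).const_smul (eval k χ)).unique ?_
  convert hasSum_coeff_mul (gauge hα χ a) (gauge hα χ b) k using 2 with g
  rw [coeff_gauge, coeff_gauge, Submodule.coe_smul, Submodule.coe_smul, twist_smul_left,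
    twist_smul_right, smul_smul, ← eval_add, add_sub_cancel]

theorem gauge_star (χ : Dual Γ) (a : L1 hα) : gauge hα χ (star a) = star (gauge hα χ a) := by
  refine ext fun k ↦ Subtype.ext ?_
  rw [coeff_gauge, coe_coeff_star, coeff_gauge, Submodule.coe_smul, Submodule.coe_smul, star_smul,
    ← eval_neg, neg_neg, coe_coeff_star]

/-- The orbit is a series of continuous functions dominated by the summable ‖a_g‖, so it converges
uniformly in χ. Norm continuity is what makes the averages over the dual group meaningful. -/
theorem continuous_gauge (a : L1 hα) : Continuous fun χ ↦ gauge hα χ a := by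
  have h : (fun χ ↦ gauge hα χ a) = fun χ ↦ ∑' g, eval g χ • single hα g (a.coeff g) := by
    funext χ
    rw [← (hasSum_single (gauge hα χ a)).tsum_eq]
    exact tsum_congr fun g ↦ map_smul _ _ _
  rw [h]
  refine continuous_tsum (fun g ↦ (continuous_eval g).smul continuous_const) a.hasSum_norm.summable
    fun g χ ↦ ?_
  rw [norm_smul, norm_eval, one_mul, norm_single]

/-- The coefficients of an element are the Fourier coefficients of its orbit under the dual
action. -/
theorem integral_gauge (a : L1 hα) (g : Γ) :
    ∫ χ, eval (-g) χ • gauge hα χ a ∂(haar Γ) = single hα g (a.coeff g) := by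
  have hi : Integrable (fun χ ↦ eval (-g) χ • gauge hα χ a) (haar Γ) :=
    integrable_eval_smul (continuous_gauge a) _
  refine ext fun k ↦ ?_
  rw [← coeffCLM_apply, ← ContinuousLinearMap.integral_comp_comm _ hi]
  simp only [map_smul, coeffCLM_apply, coeff_gauge, smul_smul, ← eval_add]
  -- In degree `k` only the scalar integral of χ(k - g) remains.
  rw [integral_smul_const, integral_eval]
  by_cases h : k = g
  · subst h
    rw [if_pos (neg_add_cancel k), one_smul, coeff_single_self]
  · rw [if_neg (fun e ↦ h (neg_add_eq_zero.mp e).symm), zero_smul, coeff_single_of_ne _ h]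

end L1

/-- C⋆-seminorms pull back along `*`-homomorphisms; isometry for the ℓ¹-norm preserves the
domination `le_norm`. -/
theorem IsCStarSeminorm.comp_gauge {p : Seminorm ℂ (L1 hα)} (hp : IsCStarSeminorm p)
    (χ : Dual Γ) : IsCStarSeminorm (p.comp (L1.gauge hα χ).toLinearMap) where
  le_norm a := (hp.le_norm _).trans_eq (L1.norm_gauge χ a)
  mul_le a b := by
    change p (L1.gauge hα χ (a * b)) ≤ _
    rw [L1.gauge_mul]
    exact hp.mul_le _ _
  star_mul_self a := by
    change p (L1.gauge hα χ (star a * a)) = _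
    rw [L1.gauge_mul, L1.gauge_star]
    exact hp.star_mul_self _

/-- The supremum runs over a family stable under pullback by χ. -/
theorem maxNorm_gauge_le (χ : Dual Γ) (a : L1 hα) : maxNorm (L1.gauge hα χ a) ≤ maxNorm a :=
  ciSup_le fun p ↦ (p.2.comp_gauge χ).le_maxNorm a

/-! ### The integrated form of a fine representation and Bessel's inequality -/

namespace FineRepresentation

variable {H : Type w} [NormedAddCommGroup H] [InnerProductSpace ℂ H] [CompleteSpace H]
  (R : FineRepresentation α H)

theorem norm_homog_le (g : Γ) (a : A) : ‖R.homog g a‖ ≤ ‖a‖ := by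
  have h1 := R.norm_op_le (cabs g)
  have h2 := R.norm_rep a
  unfold homog
  split_ifs
  · exact (norm_mul_le _ _).trans (by rw [h2]; exact mul_le_of_le_one_right (norm_nonneg _) h1)
  · refine (norm_mul_le _ _).trans ?_
    rw [norm_star, h2]
    exact mul_le_of_le_one_left (norm_nonneg _) h1

/-- For g ≥ 0 the coefficient absorbs α_g(1), and π(α_g(1)) = U_g U_g⋆, so π(a) is recovered from
π(a) U_g by multiplying with the contraction U_g⋆. The negative case is the mirror image. With
`norm_homog_le`, the operator of degree g depends isometrically on its admissible coefficient. -/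
theorem norm_le_norm_homog {g : Γ} {a : A} (ha : a ∈ fiber α g) : ‖a‖ ≤ ‖R.homog g a‖ := by
  have h1 := R.norm_op_le (cabs g)
  have h2 : ‖star (R.op (cabs g))‖ ≤ 1 := by rwa [norm_star]
  unfold homog
  split_ifs with hg
  · rw [← R.norm_rep a]
    conv_lhs => rw [← ha.1 hg, map_mul, ← R.op_mul_star, ← mul_assoc]
    exact (norm_mul_le _ _).trans (mul_le_of_le_one_right (norm_nonneg _) h2)
  · rw [← R.norm_rep a]
    conv_lhs => rw [← ha.2 (not_le.mp hg).le, map_mul, ← R.op_mul_star, mul_assoc]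
    exact (norm_mul_le _ _).trans (mul_le_of_le_one_left (norm_nonneg _) h1)

theorem homog_add (g : Γ) (a b : A) : R.homog g (a + b) = R.homog g a + R.homog g b := by
  unfold homog; split_ifs <;> simp [add_mul, mul_add]

theorem homog_smul (g : Γ) (c : ℂ) (a : A) : R.homog g (c • a) = c • R.homog g a := by
  unfold homog; split_ifs <;> simp

theorem homog_zero_left (a : A) : R.homog 0 a = R.rep a := by
  simp [homog, cabs_zero, R.op_zero]

theorem summable_homog (f : L1 hα) : Summable fun g ↦ R.homog g (f.coeff g : A) :=
  Summable.of_norm_bounded f.hasSum_norm.summable fun g ↦ R.norm_homog_le g _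

variable (hα) in
/-- The integrated form `∑ a_g δ_g ↦ ∑_{x ≥ 0} π(a_x) U_x + ∑_{x > 0} U_x⋆ π(a_{-x})` of a fine
representation. -/
def integrated : L1 hα →L[ℂ] (H →L[ℂ] H) :=
  LinearMap.mkContinuous
    { toFun := fun f ↦ ∑' g, R.homog g (f.coeff g : A)
      map_add' := fun f f' ↦ by
        rw [← (R.summable_homog f).tsum_add (R.summable_homog f')]
        exact tsum_congr fun g ↦ R.homog_add g _ _
      map_smul' := fun c f ↦ by
        rw [RingHom.id_apply, ← (R.summable_homog f).tsum_const_smul]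
        exact tsum_congr fun g ↦ R.homog_smul g c _ } 1 (fun f ↦ by
      rw [one_mul]
      exact tsum_of_norm_bounded f.hasSum_norm fun g ↦ R.norm_homog_le g _)

theorem hasSum_integrated (f : L1 hα) :
    HasSum (fun g ↦ R.homog g (f.coeff g : A)) (R.integrated hα f) :=
  (R.summable_homog f).hasSum

theorem norm_integrated_le (f : L1 hα) : ‖R.integrated hα f‖ ≤ ‖f‖ :=
  tsum_of_norm_bounded f.hasSum_norm fun g ↦ R.norm_homog_le g _

theorem integrated_single (g : Γ) (a : fiber α g) :
    R.integrated hα (L1.single hα g a) = R.homog g a := by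
  refine (R.hasSum_integrated _).unique ?_
  convert hasSum_ite_eq g (R.homog g (a : A)) using 2 with h
  rw [L1.coe_coeff_single]
  split_ifs with h1 h2 h2
  · subst h1; rfl
  · exact absurd h1.symm h2
  · exact absurd h2.symm h1
  · simp [homog]

/-- Both sides are continuous and bilinear, so it suffices to compare them on elements a δ_g and b
δ_h, where `homog_twist` applies. -/
theorem integrated_mul (a b : L1 hα) :
    R.integrated hα (a * b) = R.integrated hα a * R.integrated hα b := by
  let T := R.integrated hα
  let M := ContinuousLinearMap.mul ℂ (H →L[ℂ] H)
  refine DFunLike.congr_fun (L1.clm_ext (S := T.comp ((L1.mulCLM hα).flip b))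
    (T := (M.flip (T b)).comp T) fun g x ↦ ?_) a
  change T (L1.single hα g x * b) = T (L1.single hα g x) * T b
  refine DFunLike.congr_fun (L1.clm_ext (S := T.comp (L1.mulCLM hα (L1.single hα g x)))
    (T := (M (T (L1.single hα g x))).comp T) fun h y ↦ ?_) b
  change T (L1.single hα g x * L1.single hα h y) = T (L1.single hα g x) * T (L1.single hα h y)
  rw [L1.single_mul_single, R.integrated_single, R.integrated_single, R.integrated_single]
  exact R.homog_twist hα x.2 y.2

theorem integrated_star (a : L1 hα) : R.integrated hα (star a) = star (R.integrated hα a) := by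
  refine (R.hasSum_integrated _).unique ?_
  have h := (Equiv.neg Γ).hasSum_iff.mpr (R.hasSum_integrated a).star
  convert h using 2 with g
  simp only [Function.comp_apply, Equiv.neg_apply]
  rw [R.star_homog, neg_neg, L1.coe_coeff_star]

/-- The operator norm pulled back along the integrated `*`-representation is one of the C⋆-seminorms
in the supremum. -/
theorem norm_integrated_le_maxNorm (f : L1 hα) : ‖R.integrated hα f‖ ≤ maxNorm f :=
  IsCStarSeminorm.le_maxNorm
    (p := (normSeminorm ℂ (H →L[ℂ] H)).comp (R.integrated hα).toLinearMap)
    { le_norm := R.norm_integrated_le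
      mul_le := fun a b ↦ by
        change ‖R.integrated hα (a * b)‖ ≤ _
        rw [R.integrated_mul]
        exact norm_mul_le _ _
      star_mul_self := fun a ↦ by
        change ‖R.integrated hα (star a * a)‖ = _
        rw [R.integrated_mul, R.integrated_star]
        exact CStarRing.norm_star_mul_self } f

theorem star_homog_coeff_star (f : L1 hα) (k : Γ) :
    R.homog (-k) ((star f).coeff (-k) : A) = star (R.homog k (f.coeff k : A)) := by
  rw [R.star_homog, L1.coe_coeff_star, neg_neg]

/-- Bessel's inequality for the coefficients. -/
theorem norm_homog_sq_le (f : L1 hα) (g : Γ) :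
    ‖R.homog g (f.coeff g : A)‖ ^ 2 ≤ ‖((star f * f).coeff 0 : A)‖ := by
  have h0 : HasSum (fun k ↦ star (R.homog k (f.coeff k : A)) * R.homog k (f.coeff k : A))
      (R.rep ((star f * f).coeff 0 : A)) := by
    have h := (L1.hasSum_coeff_mul (star f) f 0).map R.rep
      (NonUnitalStarAlgHom.isometry R.rep R.faithful).continuous
    -- The terms are indexed by the degree of the left factor, which is -k when the right factor is
    -- f_k.
    rw [← (Equiv.neg Γ).hasSum_iff] at h
    refine (congrArg (HasSum · _) (funext fun k ↦ ?_)).mp h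
    have h' := R.homog_twist hα ((star f).coeff (-k)).2 (f.coeff k).2
    rw [neg_add_cancel, R.homog_zero_left, R.star_homog_coeff_star] at h'
    change R.rep (twist hα (-k) (0 - -k) ((star f).coeff (-k)) (f.coeff (0 - -k))) = _
    rw [show (0 : Γ) - -k = k by abel, h']
  -- A single term of a sum of positive operators is below the sum, and the norm is monotone on
  -- positive operators.
  have h1 := le_hasSum h0 g fun k _ ↦ star_mul_self_nonneg _
  have h2 := CStarAlgebra.norm_le_norm_of_nonneg_of_le (star_mul_self_nonneg _) h1
  rwa [CStarRing.norm_star_mul_self, R.norm_rep, ← sq] at h2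

end FineRepresentation

theorem norm_coeff_sq_le (f : L1 hα) (g : Γ) : ‖f.coeff g‖ ^ 2 ≤ ‖(star f * f).coeff 0‖ := by
  obtain ⟨H, _, _, _, ⟨R⟩⟩ := id hα
  refine le_trans ?_ (R.norm_homog_sq_le f g)
  have h := R.norm_le_norm_homog (f.coeff g).2
  gcongr
  exact h

/-- The operator of degree g is the average over χ of χ(-g) T(χ·f), with T the integrated form, and
every integrand has norm at most ‖χ·f‖_* ≤ ‖f‖_*. The averaging takes place in ℓ¹, so the dual
action need not be implemented on the Hilbert space. -/
theorem norm_coeff_le_maxNorm (f : L1 hα) (g : Γ) : ‖f.coeff g‖ ≤ maxNorm f := by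
  obtain ⟨H, _, _, _, ⟨R⟩⟩ := id hα
  refine (R.norm_le_norm_homog (f.coeff g).2).trans ?_
  have hi : Integrable (fun χ ↦ eval (-g) χ • L1.gauge hα χ f) (haar Γ) :=
    integrable_eval_smul (L1.continuous_gauge f) _
  rw [← R.integrated_single (hα := hα), ← L1.integral_gauge,
    ← ContinuousLinearMap.integral_comp_comm _ hi]
  refine (norm_integral_le_of_norm_le_const (C := maxNorm f) (.of_forall fun χ ↦ ?_)).trans_eq
    (by simp)
  rw [map_smul, norm_smul, norm_eval, one_mul]
  exact (R.norm_integrated_le_maxNorm _).trans (maxNorm_gauge_le χ f)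

theorem maxNorm_le_norm (f : L1 hα) : maxNorm f ≤ ‖f‖ := ciSup_le fun p ↦ p.2.le_norm f

/-! ### Coefficient maps and orbits on the crossed product -/

namespace CrossedProduct

variable (hα) in
/-- The canonical map `ℓ¹(Γ, α, A) → A ⋊_α Γ`, as a continuous linear map. -/
def ofCLM : L1 hα →L[ℂ] CrossedProduct hα :=
  LinearMap.mkContinuous
    { toFun := of
      map_add' := of_add
      map_smul' := of_smul } 1 (fun f ↦ by
      rw [one_mul]
      exact (norm_of f).trans_le (maxNorm_le_norm f))

theorem ofCLM_apply (f : L1 hα) : ofCLM hα f = of f := rfl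

theorem denseRange_ofCLM : DenseRange (ofCLM hα).toLinearMap :=
  UniformSpace.Completion.denseRange_coe (α := PreCrossedProduct hα)

/-- The elements a δ_g have dense span in ℓ¹, whose image is dense in the completion. -/
theorem clm_ext {F : Type*} [NormedAddCommGroup F] [NormedSpace ℂ F]
    {S T : CrossedProduct hα →L[ℂ] F}
    (h : ∀ g a, S (of (L1.single hα g a)) = T (of (L1.single hα g a))) : S = T := by
  have h' : S.comp (ofCLM hα) = T.comp (ofCLM hα) := L1.clm_ext h
  ext a
  exact induction_on (P := fun a ↦ S a = T a) a (isClosed_eq S.continuous T.continuous)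
    fun f ↦ DFunLike.congr_fun h' f

variable (hα) in
/-- The coefficient map `E_g`. -/
def coefficient (g : Γ) : CrossedProduct hα →L[ℂ] fiber α g :=
  (L1.coeffCLM hα g).toLinearMap.extendOfNorm (ofCLM hα).toLinearMap

/-- The bound `norm_coeff_le_maxNorm` is what makes the extension genuine. In particular the
coefficient vanishes on the kernel of `of`, so injectivity of `of` need not be known beforehand. -/
theorem coefficient_of (g : Γ) (f : L1 hα) : coefficient hα g (of f) = f.coeff g :=
  LinearMap.extendOfNorm_eq denseRange_ofCLM ⟨1, fun f ↦ by
    rw [one_mul]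
    exact (norm_coeff_le_maxNorm f g).trans_eq (norm_of f).symm⟩ f

theorem isCoefficientFamily_coefficient : IsCoefficientFamily (coefficient hα) :=
  fun f _ g ↦ coefficient_of g f

/-- Elements a δ_g are finitely supported and already determine a continuous linear map. -/
theorem IsCoefficientFamily.eq {E : ∀ g : Γ, CrossedProduct hα →L[ℂ] fiber α g}
    (hE : IsCoefficientFamily E) : E = coefficient hα := by
  funext g
  refine clm_ext fun h a ↦ ?_
  rw [coefficient_of]
  refine hE _ ((Set.finite_singleton h).subset fun k hk ↦ ?_) g
  by_contra hne
  exact hk (L1.coeff_single_of_ne a hne)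

/-- Bessel's inequality survives completion because both sides are continuous in `a`. -/
theorem norm_coefficient_sq_le (g : Γ) (a : CrossedProduct hα) :
    ‖coefficient hα g a‖ ^ 2 ≤ ‖coefficient hα 0 (star a * a)‖ := by
  refine induction_on (P := fun a ↦ ‖coefficient hα g a‖ ^ 2 ≤ ‖coefficient hα 0 (star a * a)‖) a
    (isClosed_le (by fun_prop) (by fun_prop)) fun f ↦ ?_
  rw [← of_star, ← of_mul, coefficient_of, coefficient_of]
  exact norm_coeff_sq_le f g

variable (hα) in
/-- The orbit map of an element of `ℓ¹(Γ, α, A)` under the dual action. -/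
def orbitL1 : L1 hα →ₗ[ℂ] C(Dual Γ, CrossedProduct hα) where
  toFun f := ⟨fun χ ↦ ofCLM hα (L1.gauge hα χ f), (ofCLM hα).continuous.comp (L1.continuous_gauge f)⟩
  map_add' f f' := ContinuousMap.ext fun χ ↦ by simp
  map_smul' c f := ContinuousMap.ext fun χ ↦ by simp

theorem orbitL1_apply (f : L1 hα) (χ : Dual Γ) : orbitL1 hα f χ = of (L1.gauge hα χ f) := rfl

variable (hα) in
/-- The orbit map `a ↦ (χ ↦ χ · a)` of the dual action on the crossed product. -/
def orbit : CrossedProduct hα →L[ℂ] C(Dual Γ, CrossedProduct hα) :=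
  (orbitL1 hα).extendOfNorm (ofCLM hα).toLinearMap

/-- The dual action is contractive for the largest C⋆-seminorm uniformly in χ, so orbits depend
boundedly on `of f` in the supremum norm. -/
theorem orbit_of (f : L1 hα) : orbit hα (of f) = orbitL1 hα f :=
  LinearMap.extendOfNorm_eq denseRange_ofCLM ⟨1, fun f ↦ by
    rw [one_mul, ContinuousMap.norm_le _ (norm_nonneg _)]
    intro χ
    rw [orbitL1_apply, norm_of]
    exact (maxNorm_gauge_le χ f).trans_eq (norm_of f).symm⟩ f

theorem orbit_apply_one (a : CrossedProduct hα) : orbit hα a 1 = a := by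
  refine induction_on (P := fun a ↦ orbit hα a 1 = a) a
    (isClosed_eq ((continuous_eval_const (1 : Dual Γ)).comp (orbit hα).continuous)
      continuous_id) fun f ↦ ?_
  rw [orbit_of, orbitL1_apply, L1.gauge_one]

/-- On the image of ℓ¹ this is `integral_gauge` pushed through the bounded map `ofCLM`; both sides
are continuous in `a`. -/
theorem fourierCLM_orbit (g : Γ) (a : CrossedProduct hα) :
    fourierCLM _ (-g) (orbit hα a) = of (L1.single hα g (coefficient hα g a)) := by
  refine induction_on
    (P := fun a ↦ fourierCLM _ (-g) (orbit hα a) = ofCLM hα (L1.single hα g (coefficient hα g a))) a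
    (isClosed_eq (by fun_prop) (by fun_prop)) fun f ↦ ?_
  rw [orbit_of, coefficient_of, fourierCLM_apply, ← L1.integral_gauge,
    ← ContinuousLinearMap.integral_comp_comm _
      (integrable_eval_smul (L1.continuous_gauge f) _)]
  simp only [map_smul, orbitL1_apply, ofCLM_apply]

/-- An element of the crossed product is determined by its coefficients. -/
theorem eq_zero_of_coefficient_eq_zero {a : CrossedProduct hα}
    (ha : ∀ g, coefficient hα g a = 0) : a = 0 := by
  -- Bounded functionals separate points, which reduces the vector-valued orbit to scalar functions.
  refine SeparatingDual.eq_zero_of_forall_dual_eq_zero (R := ℂ) fun ω ↦ ?_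
  let f : C(Dual Γ, ℂ) := ⟨fun χ ↦ ω (orbit hα a χ), ω.continuous.comp (orbit hα a).continuous⟩
  have hf : f = 0 := eq_zero_of_fourier_eq_zero fun g ↦ by
    -- Degree `-g` is chosen so that the kernel χ(-(-g)) is the χ(g) of the goal.
    have h := congrArg ω (fourierCLM_orbit (-g) a)
    rw [ha, map_zero, ← ofCLM_apply, map_zero, map_zero, neg_neg, fourierCLM_apply,
      ← ContinuousLinearMap.integral_comp_comm _
        (integrable_eval_smul (orbit hα a).continuous g)] at h
    simp only [map_smul, smul_eq_mul] at h
    exact h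
  have h1 : ω (orbit hα a 1) = 0 := DFunLike.congr_fun hf 1
  rwa [orbit_apply_one] at h1

end CrossedProduct

end SemigroupCrossedProduct

end

open SemigroupCrossedProduct CrossedProduct in
theorem theorem6p4 {Γ : Type u} [AddCommGroup Γ] [LinearOrder Γ] [IsOrderedAddMonoid Γ]
    {A : Type v} [CStarAlgebra A] (α : SemigroupCrossedProduct.DynSystem Γ A)
    (hα : SemigroupCrossedProduct.FinelyRepresentable.{u, v, w} α) :
    (∃! E : ∀ g : Γ, SemigroupCrossedProduct.CrossedProduct hα →L[ℂ]
        SemigroupCrossedProduct.fiber α g,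
      SemigroupCrossedProduct.CrossedProduct.IsCoefficientFamily E) ∧
    ∀ E : ∀ g : Γ, SemigroupCrossedProduct.CrossedProduct hα →L[ℂ]
        SemigroupCrossedProduct.fiber α g,
      SemigroupCrossedProduct.CrossedProduct.IsCoefficientFamily E →
      ∀ a : SemigroupCrossedProduct.CrossedProduct hα,
        List.TFAE [a = 0, ∀ g : Γ, E g a = 0, E 0 (star a * a) = 0] := by
  refine ⟨⟨coefficient hα, isCoefficientFamily_coefficient, fun E hE ↦ hE.eq⟩, fun E hE a ↦ ?_⟩
  rw [hE.eq]
  tfae_have 1 → 3 := by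
    rintro rfl
    rw [mul_zero, map_zero]
  -- Bessel's inequality bounds every coefficient by the one that vanishes.
  tfae_have 3 → 2 := fun h g ↦ by
    have h1 := norm_coefficient_sq_le g a
    rw [h, norm_zero] at h1
    exact norm_le_zero_iff.mp (pow_eq_zero_iff two_ne_zero |>.mp
      (le_antisymm h1 (sq_nonneg _))).le
  tfae_have 2 → 1 := eq_zero_of_coefficient_eq_zero
  tfae_finish
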